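/- **Proposition 4.2.** Let $E=(E^0,E^1,r,s)$ be a row-finite directed graph (every vertex emits only finitely many edges; $E^0$ and $E^1$ are arbitrary sets), let $F$ be a field, and let $L_F(E)$ be the Leavitt path algebra of $E$ over $F$, with its canonical $\mathbb Z$-grading (vertices in degree $0$, edges in degree $1$, ghost edges in degree $-1$). Let $M^{\mathrm{gr}}_E$ be the abelian monoid generated by $\{v(i) \mid v\in E^0,\ i\in\mathbb Z\}$ subject to the relations $$v(i)=\sum_{e\in s^{-1}(v)} r(e)(i+1)$$ for all $i\in\mathbb Z$ and every $v\in E^0$ that is not a sink, with the $\mathbb Z$-action ${}^n v(i)=v(i+n)$. Then $L_F(E)$ has a two-sided ideal that is not graded if and only if there is a $\mathbb Z$-order-ideal $I$ of $M^{\mathrm{gr}}_E$ such that the quotient monoid $M^{\mathrm{gr}}_E/I$ has a periodic element. Here a $\mathbb Z$-order-ideal $I$ of $M=M^{\mathrm{gr}}_E$ is a submonoid that is closed under the action and such that $a+c\in I$ implies $a\in I$. The monoid $M/I$ is the quotient of $M$ by the congruence $a\sim b \iff a+i=b+j$ for some $i,j\in I$, with the induced action. A periodic element is an element $a\neq 0$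 with ${}^n a=a$ for some $n\neq 0$ in $\mathbb Z$. -/

import Mathlib

universe u w x

/-! ### Directed graphs -/

/-- A directed graph with vertex set `V`, edge set `A` (loops and parallel edges allowed),
with source and range maps. -/
structure DirGraph (V : Type u) (A : Type w) where
  src : A → V
  rng : A → V

namespace DirGraph

variable {V : Type u} {A : Type w} (E : DirGraph V A)

/-- The set of edges emitted by the vertex `v`. -/
def outEdges (v : V) : Set A := {e | E.src e = v}

/-- Every vertex emits finitely many edges. -/
def RowFinite : Prop := ∀ v, (E.outEdges v).Finite

end DirGraph

/-! ### Leavitt path algebras -/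

/-- The generators of a Leavitt path algebra: the vertices, the edges `e`
and the ghost edges `e*`. -/
inductive LeavittGen (V : Type u) (A : Type w) : Type (max u w)
  | vertex (v : V)
  | edge (e : A)
  | ghost (e : A)

/-- Vertices have degree `0`, edges degree `1`, ghost edges degree `-1`. -/
def LeavittGen.degree {V : Type u} {A : Type w} : LeavittGen V A → ℤ
  | .vertex _ => 0
  | .edge _ => 1
  | .ghost _ => -1

namespace DirGraph

open LeavittGen

variable {V : Type u} {A : Type w} (E : DirGraph V A) (F : Type x) [Field F]

/-- The defining relations of the Leavitt path algebra `L_F(E)`. -/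
inductive LeavittRel :
    FreeAlgebra F (LeavittGen V A) → FreeAlgebra F (LeavittGen V A) → Prop
  | vertex_idem (v : V) :
      LeavittRel (FreeAlgebra.ι F (vertex v) * FreeAlgebra.ι F (vertex v))
        (FreeAlgebra.ι F (vertex v))
  | vertex_orth (v v' : V) (h : v ≠ v') :
      LeavittRel (FreeAlgebra.ι F (vertex v) * FreeAlgebra.ι F (vertex v')) 0
  | src_edge (e : A) :
      LeavittRel (FreeAlgebra.ι F (vertex (E.src e)) * FreeAlgebra.ι F (edge e))
        (FreeAlgebra.ι F (edge e))
  | edge_rng (e : A) :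
      LeavittRel (FreeAlgebra.ι F (edge e) * FreeAlgebra.ι F (vertex (E.rng e)))
        (FreeAlgebra.ι F (edge e))
  | rng_ghost (e : A) :
      LeavittRel (FreeAlgebra.ι F (vertex (E.rng e)) * FreeAlgebra.ι F (ghost e))
        (FreeAlgebra.ι F (ghost e))
  | ghost_src (e : A) :
      LeavittRel (FreeAlgebra.ι F (ghost e) * FreeAlgebra.ι F (vertex (E.src e)))
        (FreeAlgebra.ι F (ghost e))
  | ck1_same (e : A) :
      LeavittRel (FreeAlgebra.ι F (ghost e) * FreeAlgebra.ι F (edge e))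
        (FreeAlgebra.ι F (vertex (E.rng e)))
  | ck1_ne (e f : A) (h : e ≠ f) :
      LeavittRel (FreeAlgebra.ι F (ghost e) * FreeAlgebra.ι F (edge f)) 0
  | ck2 (v : V) (hfin : (E.outEdges v).Finite) (hne : (E.outEdges v).Nonempty) :
      LeavittRel (FreeAlgebra.ι F (vertex v))
        (∑ e ∈ hfin.toFinset, FreeAlgebra.ι F (edge e) * FreeAlgebra.ι F (ghost e))

/-- The *unital* `F`-algebra presented by the generators and relations of `L_F(E)`.
Since no relation has a constant term, this is the unitization `F ⊕ L_F(E)` of the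
(in general non-unital) algebra `L_F(E)` with the same presentation. -/
abbrev LeavittUnitization : Type (max u w x) := RingQuot (E.LeavittRel F)

/-- The image of a generator in the unitization. -/
def leavittGenUnitization (g : LeavittGen V A) : E.LeavittUnitization F :=
  RingQuot.mkAlgHom F (E.LeavittRel F) (FreeAlgebra.ι F g)

/-- The Leavitt path algebra `L_F(E)`, the (in general non-unital) `F`-algebra presented by the
generators and relations above: it consists of the linear combinations of nonempty products of
generators inside its unitization. -/
abbrev LeavittPathAlgebra : Type (max u w x) :=
  ↥(NonUnitalAlgebra.adjoin F (Set.range (E.leavittGenUnitization F)))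

/-- The generators of `L_F(E)`. -/
def leavittGen (g : LeavittGen V A) : E.LeavittPathAlgebra F :=
  ⟨E.leavittGenUnitization F g, NonUnitalAlgebra.subset_adjoin F ⟨g, rfl⟩⟩

/-- `E.LeavittMonomial F n y`: the element `y` of `L_F(E)` is a nonempty product of generators
whose degrees add up to `n`. -/
inductive LeavittMonomial : ℤ → E.LeavittPathAlgebra F → Prop
  | gen (g : LeavittGen V A) : LeavittMonomial g.degree (E.leavittGen F g)
  | mul {m n : ℤ} {y z : E.LeavittPathAlgebra F} (hy : LeavittMonomial m y)
      (hz : LeavittMonomial n z) : LeavittMonomial (m + n) (y * z)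

/-- The homogeneous component of degree `n` of the `ℤ`-graded algebra `L_F(E)`. -/
def leavittComponent (n : ℤ) : Submodule F (E.LeavittPathAlgebra F) :=
  Submodule.span F {y | E.LeavittMonomial F n y}

/-- A two-sided ideal `J` of `L_F(E)` is graded if each of its elements is a finite sum of
homogeneous elements of `J`, i.e. `J = ⨁ₙ (J ∩ L_F(E)ₙ)`. -/
def IsGradedIdeal (J : TwoSidedIdeal (E.LeavittPathAlgebra F)) : Prop :=
  ∀ y ∈ J, y ∈ AddSubmonoid.closure {z | z ∈ J ∧ ∃ n : ℤ, z ∈ E.leavittComponent F n}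

end DirGraph

/-! ### Abelian monoids with a group action -/

/-- A `Γ`-order-ideal of a `Γ`-monoid `M`: a submonoid closed under the action and hereditary for
the preorder `a ≤ b ↔ ∃ c, b = a + c`. -/
structure OrderIdeal (Γ : Type w) (M : Type u) [Group Γ] [AddCommMonoid M]
    [DistribMulAction Γ M] extends AddSubmonoid M where
  smul_mem' : ∀ (γ : Γ) {a : M}, a ∈ carrier → γ • a ∈ carrier
  hereditary' : ∀ {a b : M}, (∃ c, b = a + c) → b ∈ carrier → a ∈ carrier

namespace OrderIdeal

variable {Γ : Type w} {M : Type u} [Group Γ] [AddCommMonoid M] [DistribMulAction Γ M]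
  (I : OrderIdeal Γ M)

/-- The congruence `a ∼ b ↔ ∃ i j ∈ I, a + i = b + j`. -/
def con : AddCon M where
  r a b := ∃ i ∈ I.toAddSubmonoid, ∃ j ∈ I.toAddSubmonoid, a + i = b + j
  iseqv := by
    refine ⟨fun a => ⟨0, zero_mem _, 0, zero_mem _, rfl⟩, ?_, ?_⟩
    · rintro a b ⟨i, hi, j, hj, h⟩
      exact ⟨j, hj, i, hi, h.symm⟩
    · rintro a b c ⟨i, hi, j, hj, h⟩ ⟨k, hk, l, hl, h'⟩
      refine ⟨i + k, add_mem hi hk, l + j, add_mem hl hj, ?_⟩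
      rw [← add_assoc, h, add_right_comm, h', add_assoc]
  add' := by
    rintro a b c d ⟨i, hi, j, hj, h⟩ ⟨k, hk, l, hl, h'⟩
    refine ⟨i + k, add_mem hi hk, j + l, add_mem hj hl, ?_⟩
    rw [add_add_add_comm, h, h', add_add_add_comm]

/-- The quotient monoid `M / I`. -/
abbrev Quotient : Type u := I.con.Quotient

/-- The action of `γ` on `M / I`, induced by the action on `M`. -/
def quotientSMulHom (γ : Γ) : I.Quotient →+ I.Quotient :=
  I.con.lift (I.con.mk'.comp (DistribSMul.toAddMonoidHom M γ)) (by
    rintro a b ⟨i, hi, j, hj, h⟩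
    refine (AddCon.eq I.con).2 ⟨γ • i, I.smul_mem' γ hi, γ • j, I.smul_mem' γ hj, ?_⟩
    simp only [DistribSMul.toAddMonoidHom_apply, ← smul_add, h])

instance : DistribMulAction Γ I.Quotient where
  smul γ a := I.quotientSMulHom γ a
  one_smul a := by
    induction a using AddCon.induction_on with
    | _ a => exact congrArg (I.con.mk') (one_smul Γ a)
  mul_smul γ δ a := by
    induction a using AddCon.induction_on with
    | _ a => exact congrArg (I.con.mk') (mul_smul γ δ a)
  smul_zero γ := map_zero (I.quotientSMulHom γ)
  smul_add γ a b := map_add (I.quotientSMulHom γ) a b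

end OrderIdeal

/-- A periodic element of a `Γ`-monoid: a nonzero element fixed by some `γ ≠ 1`. -/
def IsPeriodicElement (Γ : Type w) {M : Type u} [Group Γ] [AddCommMonoid M]
    [DistribMulAction Γ M] (a : M) : Prop :=
  a ≠ 0 ∧ ∃ γ : Γ, γ ≠ 1 ∧ γ • a = a

/-! ### The graded graph monoid -/

namespace DirGraph

variable {V : Type u} {A : Type w} (E : DirGraph V A)

/-- The defining relations `v(i) = ∑_{e ∈ s⁻¹(v)} r(e)(i+1)`, for `v` not a sink, on the free
abelian monoid on the symbols `v(i)`; here `v(i)` is `Finsupp.single (v, i) 1`. (A vertex emitting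
infinitely many edges, which does not occur in a row-finite graph, gets no relation.) -/
inductive TalentedRel : ((V × ℤ) →₀ ℕ) → ((V × ℤ) →₀ ℕ) → Prop
  | expand (v : V) (i : ℤ) (hfin : (E.outEdges v).Finite) (hne : (E.outEdges v).Nonempty) :
      TalentedRel (Finsupp.single (v, i) 1)
        (∑ e ∈ hfin.toFinset, Finsupp.single (E.rng e, i + 1) 1)

/-- The graded graph monoid `M^gr_E`. -/
abbrev TalentedMonoid : Type u := (addConGen E.TalentedRel).Quotient

/-- The shift `v(k) ↦ v(k + n)` on the free abelian monoid. -/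
noncomputable def freeShift (V : Type u) (n : ℤ) : ((V × ℤ) →₀ ℕ) →+ ((V × ℤ) →₀ ℕ) :=
  Finsupp.mapDomain.addMonoidHom fun p => (p.1, p.2 + n)

theorem freeShift_single (n : ℤ) (v : V) (k : ℤ) (m : ℕ) :
    freeShift V n (Finsupp.single (v, k) m) = Finsupp.single (v, k + n) m := by
  simp [freeShift]

/-- The shift `v(k) ↦ v(k + n)` on `M^gr_E`. -/
noncomputable def shift (n : ℤ) : E.TalentedMonoid →+ E.TalentedMonoid :=
  (addConGen E.TalentedRel).lift ((addConGen E.TalentedRel).mk'.comp (freeShift V n)) (by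
    refine AddCon.addConGen_le.2 ?_
    rintro _ _ ⟨v, i, hfin, hne⟩
    refine (AddCon.eq _).2 ?_
    rw [freeShift_single, map_sum]
    simp only [freeShift_single, add_right_comm i 1 n]
    exact AddConGen.Rel.of _ _ (TalentedRel.expand v (i + n) hfin hne))

/-- The `ℤ`-action `ⁿv(k) = v(k + n)` on `M^gr_E`; the group `ℤ` is written multiplicatively. -/
noncomputable instance : DistribMulAction (Multiplicative ℤ) E.TalentedMonoid where
  smul n a := E.shift n.toAdd a
  one_smul a := by
    induction a using AddCon.induction_on with
    | _ a =>
      refine congrArg ((addConGen E.TalentedRel).mk') ?_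
      change freeShift V 0 a = a
      simp only [freeShift, Finsupp.mapDomain.addMonoidHom, add_zero]
      exact Finsupp.mapDomain_id
  mul_smul m n a := by
    induction a using AddCon.induction_on with
    | _ a =>
      refine congrArg ((addConGen E.TalentedRel).mk') ?_
      change freeShift V (m.toAdd + n.toAdd) a = freeShift V m.toAdd (freeShift V n.toAdd a)
      induction a using Finsupp.induction_linear with
      | zero => simp
      | add f g hf hg => simp only [map_add, hf, hg]
      | single p k =>
        obtain ⟨v, i⟩ := p
        simp only [freeShift_single]
        congr 2
        ring
  smul_zero n := map_zero (E.shift n.toAdd)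
  smul_add n a b := map_add (E.shift n.toAdd) a b

end DirGraph

/-! Both conditions say that some quotient graph `E / H` by a hereditary saturated set `H` has a
cycle without exits, i.e. that `E` violates Condition (K).

On the monoid side, the order-ideals `I` correspond to the sets `H`, and the quotient by `I` is the
graded graph monoid of `E / H`. Expanding generators by the defining relations never decreases the
number of terms, so a periodic element has a representative whose number of terms stays constant
under expansion. All vertices in its orbit then emit exactly one edge, and there are only finitely
many of them, so they lead into a cycle without exits.

On the algebra side, let `q` be the infinite path around such a cycle of length `m`. In the
representation of `L_F(E)` by operators on the functions on the infinite paths of `E / H`, the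
first vertex of the cycle and the path once around it both send `f` to `f q` times the indicator
function of `q`. They have the distinct degrees `0` and `m`, so the kernel is not graded.
Conversely, a non-graded ideal `J` contains an element `v + ∑ aₚ p` in which `v ∉ J` is a vertex and
the `p` are nonempty paths. If the number of terms is minimal, then conjugating with any edge at `v`
that ends outside `H = {u | u ∈ J}` must preserve it. So all the paths start with that edge, which
therefore is the only edge at `v` in `E / H`, and iterating this follows a cycle without exits. -/

namespace OrderIdeal

variable {Γ : Type w} {M : Type u} [Group Γ] [AddCommMonoid M] [DistribMulAction Γ M]
  (I : OrderIdeal Γ M)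

theorem mem_of_add_mem {a b : M} (h : a + b ∈ I.toAddSubmonoid) : a ∈ I.toAddSubmonoid :=
  I.hereditary' ⟨b, rfl⟩ h

theorem mk'_eq_zero {a : M} (ha : a ∈ I.toAddSubmonoid) : I.con.mk' a = 0 :=
  (AddCon.eq I.con).2 ⟨0, zero_mem _, a, ha, by rw [zero_add, add_zero]⟩

theorem con_le_ker {N : Type*} [AddCommMonoid N] {f : M →+ N}
    (hf : ∀ a ∈ I.toAddSubmonoid, f a = 0) : I.con ≤ AddCon.ker f := by
  rintro a b ⟨i, hi, j, hj, h⟩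
  simpa [hf i hi, hf j hj] using congrArg f h

end OrderIdeal

theorem exists_isPeriodicElement_congr {Γ M N : Type*} [Group Γ] [AddCommMonoid M]
    [DistribMulAction Γ M] [AddCommMonoid N] [DistribMulAction Γ N] (f : M ≃+ N)
    (hf : ∀ (γ : Γ) (a : M), f (γ • a) = γ • f a) :
    (∃ a : M, IsPeriodicElement Γ a) ↔ ∃ b : N, IsPeriodicElement Γ b := by
  refine f.toEquiv.exists_congr fun a => and_congr f.map_ne_zero_iff.symm ?_
  exact exists_congr fun γ => and_congr_right' (by simp [← hf])

theorem IsPeriodicElement.exists_pos {M : Type*} [AddCommMonoid M]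
    [DistribMulAction (Multiplicative ℤ) M] {a : M} (ha : IsPeriodicElement (Multiplicative ℤ) a) :
    ∃ n : ℕ, 0 < n ∧ Multiplicative.ofAdd (n : ℤ) • a = a := by
  obtain ⟨-, γ, hγ, ha⟩ := ha
  refine ⟨γ.toAdd.natAbs, Int.natAbs_pos.2 hγ, ?_⟩
  obtain h | h := Int.natAbs_eq γ.toAdd
  · rwa [← h]
  · rw [← neg_eq_iff_eq_neg.2 h]
    exact inv_smul_eq_iff.2 ha.symm

namespace DirGraph

open Filter Function LeavittGen AddMonoidAlgebra

variable {V : Type u} {A : Type w} {E : DirGraph V A}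

/-! ### Quotient graphs and cycles without exits -/

section Graph

/-- A hereditary and saturated set of vertices: it is closed under following edges, and it contains
every vertex that emits edges and emits them only into the set. -/
structure HereditarySaturated (E : DirGraph V A) (H : Set V) : Prop where
  rng_mem : ∀ e, E.src e ∈ H → E.rng e ∈ H
  mem_of_forall_rng_mem : ∀ v, (E.outEdges v).Nonempty → (∀ e ∈ E.outEdges v, E.rng e ∈ H) → v ∈ H

theorem hereditarySaturated_empty : E.HereditarySaturated ∅ where
  rng_mem _ h := h
  mem_of_forall_rng_mem _ hne h := h _ hne.some_mem

namespace HereditarySaturated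

variable {H : Set V} (hH : E.HereditarySaturated H)

/-- The quotient graph `E / H`: the vertices outside `H` and the edges ending outside `H`, whose
sources then lie outside `H` as well. -/
def quotient : DirGraph {v // v ∉ H} {e // E.rng e ∉ H} where
  src e := ⟨E.src e, fun h => e.2 (hH.rng_mem e h)⟩
  rng e := ⟨E.rng e, e.2⟩

theorem mem_quotient_outEdges {v : {v // v ∉ H}} {e : {e // E.rng e ∉ H}} :
    e ∈ hH.quotient.outEdges v ↔ (e : A) ∈ E.outEdges v :=
  Subtype.ext_iff

theorem finite_quotient_outEdges {v : {v // v ∉ H}} (hfin : (E.outEdges v).Finite) :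
    (hH.quotient.outEdges v).Finite :=
  (hfin.preimage Subtype.val_injective.injOn).subset fun _ he => hH.mem_quotient_outEdges.1 he

theorem nonempty_quotient_outEdges {v : {v // v ∉ H}} (hne : (E.outEdges v).Nonempty) :
    (hH.quotient.outEdges v).Nonempty := by
  by_contra hempty
  refine v.2 (hH.mem_of_forall_rng_mem v hne fun e he => by_contra fun hr => hempty ?_)
  exact ⟨⟨e, hr⟩, hH.mem_quotient_outEdges.2 he⟩

theorem sum_quotient_outEdges {N : Type*} [AddCommMonoid N] {v : {v // v ∉ H}}
    (hfin : (E.outEdges v).Finite) (hfin' : (hH.quotient.outEdges v).Finite) {f : A → N}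
    (hf : ∀ e, E.rng e ∈ H → f e = 0) :
    ∑ e ∈ hfin'.toFinset, f e = ∑ e ∈ hfin.toFinset, f e := by
  refine Finset.sum_of_injOn Subtype.val Subtype.val_injective.injOn (fun e he => ?_)
    (fun e he hne => hf e (by_contra fun hr => hne ?_)) fun _ _ => rfl
  · simpa using hH.mem_quotient_outEdges.1 (by simpa using he)
  · exact ⟨⟨e, hr⟩, by simpa using hH.mem_quotient_outEdges.2 (by simpa using he), rfl⟩

end HereditarySaturated

/-- An infinite path, given by its sequence of edges. -/
@[ext]
structure InfinitePath (E : DirGraph V A) where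
  edge : ℕ → A
  rng_edge : ∀ i, E.rng (edge i) = E.src (edge (i + 1))

namespace InfinitePath

/-- The vertex at which an infinite path starts. -/
def start (q : E.InfinitePath) : V := E.src (q.edge 0)

/-- The infinite path obtained by removing the first `n` edges. -/
@[simps]
def drop (q : E.InfinitePath) (n : ℕ) : E.InfinitePath where
  edge i := q.edge (i + n)
  rng_edge i := by rw [q.rng_edge, Nat.add_right_comm]

/-- The infinite path `e q` obtained by prepending an edge that ends where `q` starts. -/
def cons (e : A) (q : E.InfinitePath) (h : E.rng e = q.start) : E.InfinitePath where
  edge i := Nat.casesOn i e q.edge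
  rng_edge i := Nat.casesOn i h q.rng_edge

@[simp]
theorem edge_zero_cons (e : A) (q : E.InfinitePath) (h : E.rng e = q.start) :
    (cons e q h).edge 0 = e :=
  rfl

@[simp]
theorem start_cons (e : A) (q : E.InfinitePath) (h : E.rng e = q.start) :
    (cons e q h).start = E.src e :=
  rfl

@[simp]
theorem drop_one_cons (e : A) (q : E.InfinitePath) (h : E.rng e = q.start) :
    (cons e q h).drop 1 = q :=
  rfl

theorem start_drop_one (q : E.InfinitePath) : (q.drop 1).start = E.rng (q.edge 0) :=
  (q.rng_edge 0).symm

theorem cons_drop_one (q : E.InfinitePath) :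
    cons (q.edge 0) (q.drop 1) q.start_drop_one.symm = q := by
  ext i
  cases i <;> rfl

end InfinitePath

/-- The infinite path `q` runs through a cycle of length `m` none of whose vertices emits an edge
leaving the cycle. The cycle need not be simple: `q` may run through it several times in `m`
steps. -/
structure IsExitlessCycle (q : E.InfinitePath) (m : ℕ) : Prop where
  pos : 0 < m
  outEdges_eq : ∀ i, E.outEdges (E.src (q.edge i)) = {q.edge i}
  src_eq : E.src (q.edge m) = E.src (q.edge 0)

/-- The graph has a cycle without exits. -/
def HasExitlessCycle (E : DirGraph V A) : Prop :=
  ∃ (q : E.InfinitePath) (m : ℕ), IsExitlessCycle q m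

/-- Some quotient of the graph by a hereditary saturated set has a cycle without exits, i.e. the
graph violates Condition (K). -/
def HasQuotientWithExitlessCycle (E : DirGraph V A) : Prop :=
  ∃ (H : Set V) (hH : E.HereditarySaturated H), hH.quotient.HasExitlessCycle

theorem IsExitlessCycle.eq_of_start_eq {p q : E.InfinitePath} {m : ℕ} (hq : IsExitlessCycle q m)
    (h : p.start = q.start) : p = q := by
  have edge_eq : ∀ i, E.src (p.edge i) = E.src (q.edge i) → p.edge i = q.edge i := fun i hi =>
    (hq.outEdges_eq i).subset hi
  ext i
  induction i with
  | zero => exact edge_eq 0 h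
  | succ i ih => exact edge_eq (i + 1) (by rw [← p.rng_edge, ← q.rng_edge, ih])

/-- Following the unique edges from any vertex of `W` must eventually run into a cycle. -/
theorem hasExitlessCycle_of_finite {W : Set V} (hfin : W.Finite) (hne : W.Nonempty)
    (hW : ∀ v ∈ W, ∃ e, E.outEdges v = {e} ∧ E.rng e ∈ W) : E.HasExitlessCycle := by
  obtain ⟨v, hv⟩ := hne
  obtain ⟨e, -⟩ := hW v hv
  have : Nonempty A := ⟨e⟩
  choose! edge outEdges_eq rng_mem using hW
  have src_edge : ∀ v ∈ W, E.src (edge v) = v := fun v hv =>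
    (outEdges_eq v hv).superset (Set.mem_singleton _)
  let next : V → V := fun v => E.rng (edge v)
  have orbit_mem : ∀ k, next^[k] v ∈ W := fun k =>
    (show Set.MapsTo next W W from rng_mem).iterate k hv
  obtain ⟨i, -, j, -, hij, hcycle⟩ := Set.infinite_univ.exists_lt_map_eq_of_mapsTo
    (fun k _ => orbit_mem k) hfin
  refine ⟨⟨fun k => edge (next^[k + i] v), fun k => ?_⟩, j - i, Nat.sub_pos_of_lt hij,
    fun k => ?_, ?_⟩
  · rw [src_edge _ (orbit_mem _), Nat.add_right_comm, iterate_succ_apply']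
  · rw [src_edge _ (orbit_mem _), outEdges_eq _ (orbit_mem _)]
  · simp only [Nat.sub_add_cancel hij.le, Nat.zero_add, hcycle]

end Graph

/-! ### The graded graph monoid of a quotient graph -/

section TalentedMonoid

variable (E) in
/-- The generator `v(i)` of the graded graph monoid. -/
noncomputable def talentedGen (v : V) (i : ℤ) : E.TalentedMonoid :=
  (addConGen E.TalentedRel).mk' (Finsupp.single (v, i) 1)

theorem smul_talentedGen (γ : Multiplicative ℤ) (v : V) (i : ℤ) :
    γ • E.talentedGen v i = E.talentedGen v (i + γ.toAdd) :=
  congrArg (addConGen E.TalentedRel).mk' (freeShift_single _ v i 1)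

theorem talentedGen_eq_sum {v : V} (i : ℤ) (hfin : (E.outEdges v).Finite)
    (hne : (E.outEdges v).Nonempty) :
    E.talentedGen v i = ∑ e ∈ hfin.toFinset, E.talentedGen (E.rng e) (i + 1) := by
  simp only [talentedGen, ← map_sum]
  exact (AddCon.eq _).2 (AddConGen.Rel.of _ _ (TalentedRel.expand v i hfin hne))

@[elab_as_elim]
theorem finsupp_nat_induction {α : Type*} {motive : (α →₀ ℕ) → Prop} (x : α →₀ ℕ)
    (zero : motive 0) (single : ∀ p, motive (Finsupp.single p 1))
    (add : ∀ x y, motive x → motive y → motive (x + y)) : motive x := by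
  induction x using Finsupp.induction_linear with
  | zero => exact zero
  | add x y hx hy => exact add x y hx hy
  | single p k =>
    induction k with
    | zero => simpa using zero
    | succ k ih =>
      rw [Finsupp.single_add]
      exact add _ _ ih (single p)

@[elab_as_elim]
theorem talented_induction {motive : E.TalentedMonoid → Prop} (a : E.TalentedMonoid)
    (zero : motive 0) (gen : ∀ v i, motive (E.talentedGen v i))
    (add : ∀ a b, motive a → motive b → motive (a + b)) : motive a := by
  induction a using AddCon.induction_on with | _ x
  induction x using finsupp_nat_induction with
  | zero => exact zero
  | single p => exact gen p.1 p.2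
  | add x y hx hy => exact add _ _ hx hy

/-- The additive map out of the graded graph monoid with prescribed values on the generators. -/
noncomputable def talentedLift {N : Type*} [AddCommMonoid N] (f : V → ℤ → N)
    (hf : ∀ v i (hfin : (E.outEdges v).Finite), (E.outEdges v).Nonempty →
      f v i = ∑ e ∈ hfin.toFinset, f (E.rng e) (i + 1)) : E.TalentedMonoid →+ N :=
  (addConGen E.TalentedRel).lift (Finsupp.liftAddHom fun p => multiplesHom N (f p.1 p.2)) <| by
    refine AddCon.addConGen_le.2 ?_
    rintro _ _ ⟨v, i, hfin, hne⟩
    simpa [AddCon.ker_rel] using hf v i hfin hne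

@[simp]
theorem talentedLift_gen {N : Type*} [AddCommMonoid N] {f : V → ℤ → N}
    (hf : ∀ v i (hfin : (E.outEdges v).Finite), (E.outEdges v).Nonempty →
      f v i = ∑ e ∈ hfin.toFinset, f (E.rng e) (i + 1)) (v : V) (i : ℤ) :
    talentedLift f hf (E.talentedGen v i) = f v i := by
  change Finsupp.liftAddHom _ (Finsupp.single (v, i) 1) = _
  simp

namespace HereditarySaturated

variable {H : Set V} (hH : E.HereditarySaturated H)

open Classical in
/-- The additive map to `ℕ∞` that vanishes on the generators `v(i)` with `v ∈ H` and is infinite on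
all others. -/
noncomputable def weight : E.TalentedMonoid →+ ℕ∞ :=
  talentedLift (fun v _ => if v ∈ H then 0 else ⊤) fun v _ hfin hne => by
    split_ifs with hv
    · refine (Finset.sum_eq_zero fun e he => if_pos (hH.rng_mem e ?_)).symm
      rwa [show E.src e = v by simpa [outEdges] using he]
    · obtain ⟨e, he⟩ := hH.nonempty_quotient_outEdges (v := ⟨v, hv⟩) hne
      have he' : (e : A) ∈ hfin.toFinset := by simpa using hH.mem_quotient_outEdges.1 he
      exact Eq.symm (WithTop.sum_eq_top.2 ⟨e, he', if_neg e.2⟩)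

theorem weight_gen {v : V} {i : ℤ} : hH.weight (E.talentedGen v i) = 0 ↔ v ∈ H := by
  simp [weight]

theorem weight_smul (γ : Multiplicative ℤ) (a : E.TalentedMonoid) :
    hH.weight (γ • a) = hH.weight a := by
  induction a using talented_induction with
  | zero => rw [smul_zero]
  | gen v i => simp [weight, smul_talentedGen]
  | add a b ha hb => rw [smul_add, map_add, map_add, ha, hb]

/-- The order-ideal of the graded graph monoid generated by a hereditary saturated set. -/
noncomputable def orderIdeal : OrderIdeal (Multiplicative ℤ) E.TalentedMonoid where
  toAddSubmonoid := AddMonoidHom.mker hH.weight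
  smul_mem' γ a ha := (hH.weight_smul γ a).trans ha
  hereditary' := by
    rintro a _ ⟨c, rfl⟩ h
    exact (add_eq_zero.1 ((map_add hH.weight a c).symm.trans h)).1

theorem talentedGen_mem_orderIdeal {v : V} {i : ℤ} :
    E.talentedGen v i ∈ hH.orderIdeal.toAddSubmonoid ↔ v ∈ H :=
  hH.weight_gen

open Classical in
/-- The map from the graded graph monoid of `E` to that of `E / H` that kills the generators lying
over `H`. -/
noncomputable def talentedQuotientMap : E.TalentedMonoid →+ hH.quotient.TalentedMonoid :=
  talentedLift (fun v i => if hv : v ∈ H then 0 else hH.quotient.talentedGen ⟨v, hv⟩ i)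
    fun v i hfin hne => by
      split_ifs with hv
      · refine (Finset.sum_eq_zero fun e he => dif_pos (hH.rng_mem e ?_)).symm
        rwa [show E.src e = v by simpa [outEdges] using he]
      · rw [← hH.sum_quotient_outEdges hfin (hH.finite_quotient_outEdges (v := ⟨v, hv⟩) hfin)
          fun e he => dif_pos he,
          talentedGen_eq_sum i (hH.finite_quotient_outEdges hfin)
            (hH.nonempty_quotient_outEdges hne)]
        exact Finset.sum_congr rfl fun e _ => by rw [dif_neg e.2]; rfl

theorem talentedQuotientMap_gen_of_mem {v : V} (hv : v ∈ H) (i : ℤ) :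
    hH.talentedQuotientMap (E.talentedGen v i) = 0 := by
  simp [talentedQuotientMap, hv]

theorem talentedQuotientMap_gen (v : {v // v ∉ H}) (i : ℤ) :
    hH.talentedQuotientMap (E.talentedGen v i) = hH.quotient.talentedGen v i := by
  simp [talentedQuotientMap, v.2]

theorem talentedQuotientMap_smul (γ : Multiplicative ℤ) (a : E.TalentedMonoid) :
    hH.talentedQuotientMap (γ • a) = γ • hH.talentedQuotientMap a := by
  induction a using talented_induction with
  | zero => simp only [smul_zero, map_zero]
  | gen v i => by_cases hv : v ∈ H <;> simp [talentedQuotientMap, smul_talentedGen, hv]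
  | add a b ha hb => simp only [smul_add, map_add, ha, hb]

section OrderIdeal

variable {I : OrderIdeal (Multiplicative ℤ) E.TalentedMonoid}
  (hI : ∀ v i, E.talentedGen v i ∈ I.toAddSubmonoid ↔ v ∈ H)

include hI in
theorem talentedQuotientMap_eq_zero_of_mem {a : E.TalentedMonoid} (ha : a ∈ I.toAddSubmonoid) :
    hH.talentedQuotientMap a = 0 := by
  induction a using talented_induction with
  | zero => exact map_zero _
  | gen v i => exact hH.talentedQuotientMap_gen_of_mem ((hI v i).1 ha) i
  | add a b iha ihb =>
    rw [map_add, iha (I.mem_of_add_mem ha), ihb (I.mem_of_add_mem (add_comm a b ▸ ha)), add_zero]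

/-- If the order-ideal `I` meets the generators in those lying over `H`, then the quotient of the
graded graph monoid of `E` by `I` is the graded graph monoid of `E / H`. -/
noncomputable def quotientEquiv (hE : E.RowFinite) : I.Quotient ≃+ hH.quotient.TalentedMonoid :=
  AddMonoidHom.toAddEquiv
    (I.con.lift hH.talentedQuotientMap
      (I.con_le_ker fun _ => hH.talentedQuotientMap_eq_zero_of_mem hI))
    (talentedLift (fun v i => I.con.mk' (E.talentedGen v i)) fun v i hfin hne => by
      rw [talentedGen_eq_sum i (hE v) (hne.image Subtype.val |>.mono ?_), map_sum]
      · exact (hH.sum_quotient_outEdges (hE v) hfin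
          fun e he => I.mk'_eq_zero ((hI _ _).2 he)).symm
      · exact Set.image_subset_iff.2 fun e => hH.mem_quotient_outEdges.1)
    (AddCon.hom_ext <| AddMonoidHom.ext fun a => by
      induction a using talented_induction with
      | zero => simp only [map_zero]
      | gen v i =>
        by_cases hv : v ∈ H
        · simpa [hH.talentedQuotientMap_gen_of_mem hv] using
            (I.mk'_eq_zero ((hI v i).2 hv)).symm
        · lift v to {v // v ∉ H} using hv
          simp [hH.talentedQuotientMap_gen]
      | add a b ha hb => simp only [map_add, ha, hb])
    (AddMonoidHom.ext fun a => by
      induction a using talented_induction with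
      | zero => simp only [map_zero]
      | gen v i => simp [hH.talentedQuotientMap_gen]
      | add a b ha hb => simp only [map_add, ha, hb])

theorem quotientEquiv_smul (hE : E.RowFinite) (γ : Multiplicative ℤ) (a : I.Quotient) :
    hH.quotientEquiv hI hE (γ • a) = γ • hH.quotientEquiv hI hE a := by
  induction a using AddCon.induction_on with | _ a
  exact hH.talentedQuotientMap_smul γ a

end OrderIdeal

end HereditarySaturated

/-- The vertices whose generators lie in an order-ideal. By invariance under the action it does not
matter in which degree the generator is taken. -/
def vertexSet (I : OrderIdeal (Multiplicative ℤ) E.TalentedMonoid) : Set V :=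
  {v | E.talentedGen v 0 ∈ I.toAddSubmonoid}

theorem talentedGen_mem_iff (I : OrderIdeal (Multiplicative ℤ) E.TalentedMonoid) (v : V) (i : ℤ) :
    E.talentedGen v i ∈ I.toAddSubmonoid ↔ v ∈ vertexSet I := by
  constructor <;> intro h
  · simpa [smul_talentedGen, vertexSet] using I.smul_mem' (Multiplicative.ofAdd (-i)) h
  · simpa [smul_talentedGen] using I.smul_mem' (Multiplicative.ofAdd i) h

theorem hereditarySaturated_vertexSet (hE : E.RowFinite)
    (I : OrderIdeal (Multiplicative ℤ) E.TalentedMonoid) :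
    E.HereditarySaturated (vertexSet I) where
  rng_mem e he := by
    classical
    rw [vertexSet, Set.mem_ofPred_eq, talentedGen_eq_sum 0 (hE _) ⟨e, rfl⟩,
      ← Finset.add_sum_erase _ _ (a := e) (by simp [outEdges])] at he
    exact (talentedGen_mem_iff I _ _).1 (I.mem_of_add_mem he)
  mem_of_forall_rng_mem v hne h := by
    rw [vertexSet, Set.mem_ofPred_eq, talentedGen_eq_sum 0 (hE v) hne]
    exact sum_mem fun e he => (talentedGen_mem_iff I _ _).2 (h e (by simpa using he))

theorem exists_isPeriodicElement_quotient_iff (hE : E.RowFinite) :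
    (∃ (I : OrderIdeal (Multiplicative ℤ) E.TalentedMonoid) (a : I.Quotient),
        IsPeriodicElement (Multiplicative ℤ) a) ↔
      ∃ (H : Set V) (hH : E.HereditarySaturated H) (a : hH.quotient.TalentedMonoid),
        IsPeriodicElement (Multiplicative ℤ) a := by
  constructor
  · rintro ⟨I, h⟩
    have hH := hereditarySaturated_vertexSet hE I
    have hI := talentedGen_mem_iff I
    exact ⟨_, hH, (exists_isPeriodicElement_congr _ (hH.quotientEquiv_smul hI hE)).1 h⟩
  · rintro ⟨H, hH, h⟩
    have hI : ∀ v i, E.talentedGen v i ∈ hH.orderIdeal.toAddSubmonoid ↔ v ∈ H :=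
      fun _ _ => hH.talentedGen_mem_orderIdeal
    exact ⟨_, (exists_isPeriodicElement_congr _ (hH.quotientEquiv_smul hI hE)).2 h⟩

end TalentedMonoid

/-! ### Periodic elements of the graded graph monoid -/

section Periodic

/-- A regular vertex: it emits at least one and only finitely many edges. The regular vertices are
those that carry a relation in the graded graph monoid. -/
def IsRegular (E : DirGraph V A) (v : V) : Prop := (E.outEdges v).Finite ∧ (E.outEdges v).Nonempty

open Classical in
variable (E) in
/-- The endomorphism of the free commutative monoid that applies the relation
`v(i) = ∑ r(e)(i + 1)` once to every generator over a regular vertex. -/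
noncomputable def expandOnce : Module.End ℕ ((V × ℤ) →₀ ℕ) :=
  Finsupp.linearCombination ℕ fun p =>
    if h : E.IsRegular p.1 then ∑ e ∈ h.1.toFinset, Finsupp.single (E.rng e, p.2 + 1) 1
    else Finsupp.single p 1

theorem expandOnce_single_of_isRegular {v : V} (h : E.IsRegular v) (i : ℤ) :
    E.expandOnce (Finsupp.single (v, i) 1) =
      ∑ e ∈ h.1.toFinset, Finsupp.single (E.rng e, i + 1) 1 := by
  simp [expandOnce, h]

theorem expandOnce_single_of_not_isRegular {v : V} (h : ¬ E.IsRegular v) (i : ℤ) :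
    E.expandOnce (Finsupp.single (v, i) 1) = Finsupp.single (v, i) 1 := by
  simp [expandOnce, h]

theorem mk'_expandOnce (x : (V × ℤ) →₀ ℕ) :
    (addConGen E.TalentedRel).mk' (E.expandOnce x) = (addConGen E.TalentedRel).mk' x := by
  induction x using finsupp_nat_induction with
  | zero => rw [map_zero]
  | single p =>
    by_cases h : E.IsRegular p.1
    · rw [expandOnce_single_of_isRegular h, map_sum]
      exact (talentedGen_eq_sum p.2 h.1 h.2).symm
    · rw [expandOnce_single_of_not_isRegular h]
  | add x y hx hy => simp only [map_add, hx, hy]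

theorem mk'_expandOnce_pow (k : ℕ) (x : (V × ℤ) →₀ ℕ) :
    (addConGen E.TalentedRel).mk' ((E.expandOnce ^ k) x) = (addConGen E.TalentedRel).mk' x := by
  induction k with
  | zero => rfl
  | succ k ih => rw [pow_succ', Module.End.mul_apply, mk'_expandOnce, ih]

theorem expandOnce_freeShift (n : ℤ) (x : (V × ℤ) →₀ ℕ) :
    E.expandOnce (freeShift V n x) = freeShift V n (E.expandOnce x) := by
  induction x using finsupp_nat_induction with
  | zero => simp only [map_zero]
  | single p =>
    obtain ⟨v, i⟩ := p
    by_cases h : E.IsRegular v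
    · simp only [freeShift_single, expandOnce_single_of_isRegular h, map_sum, add_right_comm]
    · simp only [freeShift_single, expandOnce_single_of_not_isRegular h]
  | add x y hx hy => simp only [map_add, hx, hy]

theorem expandOnce_pow_freeShift (k : ℕ) (n : ℤ) (x : (V × ℤ) →₀ ℕ) :
    (E.expandOnce ^ k) (freeShift V n x) = freeShift V n ((E.expandOnce ^ k) x) := by
  induction k with
  | zero => rfl
  | succ k ih => simp only [pow_succ', Module.End.mul_apply, ih, expandOnce_freeShift]

variable (E) in
/-- Expand every generator `v(i)` with `i ≤ k` up to level `k`, stopping at vertices that are not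
regular. Generators `v(i)` with `i > k` are left alone. -/
noncomputable def expandTo (k : ℤ) : ((V × ℤ) →₀ ℕ) →ₗ[ℕ] ((V × ℤ) →₀ ℕ) :=
  Finsupp.linearCombination ℕ fun p => (E.expandOnce ^ (k - p.2).toNat) (Finsupp.single p 1)

theorem expandTo_single (k : ℤ) (p : V × ℤ) :
    E.expandTo k (Finsupp.single p 1) =
      (E.expandOnce ^ (k - p.2).toNat) (Finsupp.single p 1) := by
  simp [expandTo]

theorem mk'_expandTo (k : ℤ) (x : (V × ℤ) →₀ ℕ) :
    (addConGen E.TalentedRel).mk' (E.expandTo k x) = (addConGen E.TalentedRel).mk' x := by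
  induction x using finsupp_nat_induction with
  | zero => rw [map_zero]
  | single p => rw [expandTo_single, mk'_expandOnce_pow]
  | add x y hx hy => simp only [map_add, hx, hy]

theorem expandTo_freeShift (k n : ℤ) (x : (V × ℤ) →₀ ℕ) :
    E.expandTo (k + n) (freeShift V n x) = freeShift V n (E.expandTo k x) := by
  induction x using finsupp_nat_induction with
  | zero => simp only [map_zero]
  | single p =>
    rw [freeShift_single, expandTo_single, expandTo_single, ← expandOnce_pow_freeShift,
      freeShift_single, add_sub_add_right_eq_sub]
  | add x y hx hy => simp only [map_add, hx, hy]

theorem eventually_expandOnce_pow_expandTo (x : (V × ℤ) →₀ ℕ) (j : ℕ) :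
    ∀ᶠ k in atTop, (E.expandOnce ^ j) (E.expandTo k x) = E.expandTo (k + j) x := by
  induction x using finsupp_nat_induction with
  | zero => simp
  | single p =>
    filter_upwards [eventually_ge_atTop p.2] with k hk
    rw [expandTo_single, expandTo_single, ← Module.End.mul_apply, ← pow_add]
    congr 2
    omega
  | add x y hx hy =>
    filter_upwards [hx, hy] with k hkx hky
    rw [map_add, map_add, map_add, hkx, hky]

theorem eventually_expandTo_eq {x y : (V × ℤ) →₀ ℕ}
    (h : (addConGen E.TalentedRel).mk' x = (addConGen E.TalentedRel).mk' y) :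
    ∀ᶠ k in atTop, E.expandTo k x = E.expandTo k y := by
  replace h : AddConGen.Rel E.TalentedRel x y := (AddCon.eq _).1 h
  induction h with
  | of x y hxy =>
    obtain ⟨v, i, hfin, hne⟩ := hxy
    filter_upwards [eventually_gt_atTop i] with k hk
    have hlevel : (k - i).toNat = (k - (i + 1)).toNat + 1 := by omega
    rw [expandTo_single, hlevel, pow_succ, Module.End.mul_apply,
      expandOnce_single_of_isRegular ⟨hfin, hne⟩, map_sum, map_sum]
    simp only [expandTo_single]
  | refl x => exact Eventually.of_forall fun _ => rfl
  | symm _ ih => exact ih.mono fun _ => Eq.symm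
  | trans _ _ ih ih' => filter_upwards [ih, ih'] with k hk hk' using hk.trans hk'
  | add _ _ ih ih' =>
    filter_upwards [ih, ih'] with k hk hk'
    rw [map_add, map_add, hk, hk']

theorem exists_expandOnce_pow_eq_freeShift {a : E.TalentedMonoid}
    (ha : IsPeriodicElement (Multiplicative ℤ) a) :
    ∃ n : ℕ, 0 < n ∧ ∃ y ≠ 0, (E.expandOnce ^ n) y = freeShift V n y := by
  obtain ⟨n, hn, hna⟩ := ha.exists_pos
  induction a using AddCon.induction_on with | _ x
  have hx : (addConGen E.TalentedRel).mk' (freeShift V n x) = (addConGen E.TalentedRel).mk' x := hna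
  obtain ⟨k, hpow, hshift⟩ := ((eventually_expandOnce_pow_expandTo x n).and
    ((tendsto_atTop_add_const_right atTop (n : ℤ) tendsto_id).eventually
      (eventually_expandTo_eq hx))).exists
  refine ⟨n, hn, E.expandTo k x, fun h => ha.1 ?_, ?_⟩
  · change (addConGen E.TalentedRel).mk' x = 0
    rw [← mk'_expandTo k, h, map_zero]
  · rw [hpow, ← expandTo_freeShift]
    exact hshift.symm

theorem degree_le_degree_expandOnce (x : (V × ℤ) →₀ ℕ) : x.degree ≤ (E.expandOnce x).degree := by
  induction x using finsupp_nat_induction with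
  | zero => simp
  | single p =>
    by_cases h : E.IsRegular p.1
    · rw [expandOnce_single_of_isRegular h, map_sum]
      simpa using h.2
    · rw [expandOnce_single_of_not_isRegular h]
  | add x y hx hy =>
    rw [map_add, map_add, map_add]
    exact add_le_add hx hy

theorem degree_freeShift (n : ℤ) (x : (V × ℤ) →₀ ℕ) : (freeShift V n x).degree = x.degree :=
  Finsupp.degree_mapDomain _ _

theorem freeShift_apply (n : ℤ) (x : (V × ℤ) →₀ ℕ) (v : V) (i : ℤ) :
    freeShift V n x (v, i) = x (v, i - n) := by
  have hinj : Injective fun p : V × ℤ => (p.1, p.2 + n) := fun p q h => by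
    simpa [Prod.ext_iff] using h
  simpa using! Finsupp.mapDomain_apply hinj x (v, i - n)

theorem exists_eq_single_add {α : Type*} {x : α →₀ ℕ} {p : α} (hp : x p ≠ 0) :
    ∃ y, x = Finsupp.single p 1 + y :=
  exists_add_of_le (Finsupp.single_le_iff.2 (Nat.one_le_iff_ne_zero.2 hp))

theorem expandOnce_apply_ne_zero {x : (V × ℤ) →₀ ℕ} {p q : V × ℤ} (hp : x p ≠ 0)
    (hpq : E.expandOnce (Finsupp.single p 1) = Finsupp.single q 1) : E.expandOnce x q ≠ 0 := by
  obtain ⟨y, rfl⟩ := exists_eq_single_add hp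
  simp [hpq]

theorem exists_outEdges_eq_singleton {x : (V × ℤ) →₀ ℕ} {v : V} {i : ℤ} (hv : E.IsRegular v)
    (hp : x (v, i) ≠ 0) (hdeg : (E.expandOnce x).degree ≤ x.degree) :
    ∃ e, E.outEdges v = {e} ∧ E.expandOnce x (E.rng e, i + 1) ≠ 0 := by
  have hcard : hv.1.toFinset.card ≤ 1 := by
    obtain ⟨y, rfl⟩ := exists_eq_single_add hp
    have hy := degree_le_degree_expandOnce (E := E) y
    rw [map_add, expandOnce_single_of_isRegular hv] at hdeg
    simp only [map_add, map_sum, Finsupp.degree_single, Finset.sum_const, smul_eq_mul,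
      mul_one] at hdeg
    omega
  obtain ⟨e, he⟩ := hv.2
  have heq : hv.1.toFinset = {e} := Finset.eq_singleton_iff_unique_mem.2
    ⟨by simpa using he, fun f hf => Finset.card_le_one.1 hcard f hf e (by simpa using he)⟩
  refine ⟨e, by simpa using congrArg (fun s : Finset A => (s : Set A)) heq, ?_⟩
  refine expandOnce_apply_ne_zero hp ?_
  rw [expandOnce_single_of_isRegular hv, heq, Finset.sum_singleton]

section ExpansionOrbit

variable {y : (V × ℤ) →₀ ℕ} {n : ℕ} (hy : (E.expandOnce ^ n) y = freeShift V n y)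

include hy

theorem expandOnce_pow_add (k : ℕ) :
    (E.expandOnce ^ (k + n)) y = freeShift V n ((E.expandOnce ^ k) y) := by
  rw [pow_add, Module.End.mul_apply, hy, expandOnce_pow_freeShift]

theorem expandOnce_pow_add_mul_apply (k t : ℕ) (v : V) (i : ℤ) :
    (E.expandOnce ^ (k + t * n)) y (v, i) = (E.expandOnce ^ k) y (v, i - t * n) := by
  induction t generalizing i with
  | zero => simp
  | succ t ih =>
    rw [Nat.succ_mul, ← add_assoc, expandOnce_pow_add hy, freeShift_apply, ih]
    congr 2
    push_cast
    ring

theorem degree_expandOnce_pow_succ_le (hn : 0 < n) (k : ℕ) :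
    (E.expandOnce ((E.expandOnce ^ k) y)).degree ≤ ((E.expandOnce ^ k) y).degree := by
  have hmono : Monotone fun k => ((E.expandOnce ^ k) y).degree := by
    refine monotone_nat_of_le_succ fun k => ?_
    rw [pow_succ', Module.End.mul_apply]
    exact degree_le_degree_expandOnce _
  calc (E.expandOnce ((E.expandOnce ^ k) y)).degree
      = ((E.expandOnce ^ (k + 1)) y).degree := by rw [pow_succ', Module.End.mul_apply]
    _ ≤ ((E.expandOnce ^ (k + n)) y).degree := hmono (by omega)
    _ = ((E.expandOnce ^ k) y).degree := by rw [expandOnce_pow_add hy, degree_freeShift]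

/-- A generator over a vertex that is not regular would survive all expansions, and the periodicity
would force infinitely many of its translates into the support. -/
theorem isRegular_of_expandOnce_pow_apply_ne_zero (hn : 0 < n) {k : ℕ} {v : V} {i : ℤ}
    (hp : (E.expandOnce ^ k) y (v, i) ≠ 0) : E.IsRegular v := by
  by_contra hv
  have persists : ∀ t, (E.expandOnce ^ (k + t)) y (v, i) ≠ 0 := fun t => by
    induction t with
    | zero => exact hp
    | succ t ih =>
      rw [← add_assoc, pow_succ', Module.End.mul_apply]
      exact expandOnce_apply_ne_zero ih (expandOnce_single_of_not_isRegular hv i)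
  have translates : ∀ t : ℕ, (v, i - t * n) ∈ ((E.expandOnce ^ k) y).support := fun t => by
    rw [Finsupp.mem_support_iff, ← expandOnce_pow_add_mul_apply hy]
    exact persists _
  refine Set.infinite_of_injective_forall_mem (fun s t hst => ?_) translates
    (Finset.finite_toSet _)
  simpa [hn.ne'] using hst

theorem hasExitlessCycle_of_expandOnce_pow_eq (hn : 0 < n) (hy0 : y ≠ 0) : E.HasExitlessCycle := by
  refine hasExitlessCycle_of_finite (W := {v | ∃ k i, (E.expandOnce ^ k) y (v, i) ≠ 0}) ?_ ?_ ?_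
  · have hfin (k : ℕ) : {v | ∃ i, (E.expandOnce ^ k) y (v, i) ≠ 0}.Finite :=
      (((E.expandOnce ^ k) y).support.finite_toSet.image Prod.fst).subset fun v ⟨i, hi⟩ =>
        ⟨(v, i), Finsupp.mem_support_iff.2 hi, rfl⟩
    refine ((Set.finite_Iio n).biUnion fun k _ => hfin k).subset ?_
    rintro v ⟨k, i, hp⟩
    rw [← Nat.mod_add_div' k n, expandOnce_pow_add_mul_apply hy] at hp
    exact Set.mem_biUnion (Set.mem_Iio.2 (Nat.mod_lt k hn)) ⟨_, hp⟩
  · obtain ⟨p, hp⟩ := Finsupp.ne_iff.1 hy0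
    exact ⟨p.1, 0, p.2, hp⟩
  · rintro v ⟨k, i, hp⟩
    have hv := isRegular_of_expandOnce_pow_apply_ne_zero hy hn hp
    obtain ⟨e, heq, he⟩ :=
      exists_outEdges_eq_singleton hv hp (degree_expandOnce_pow_succ_le hy hn k)
    exact ⟨e, heq, k + 1, i + 1, by rwa [pow_succ', Module.End.mul_apply]⟩

end ExpansionOrbit

theorem talentedGen_ne_zero (v : V) (i : ℤ) : E.talentedGen v i ≠ 0 := fun h => by
  simpa [h] using (hereditarySaturated_empty (E := E)).weight_gen (v := v) (i := i)

theorem IsExitlessCycle.isPeriodicElement {q : E.InfinitePath} {m : ℕ} (hq : IsExitlessCycle q m) :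
    IsPeriodicElement (Multiplicative ℤ) (E.talentedGen (E.src (q.edge 0)) 0) := by
  have step (k : ℕ) (i : ℤ) : E.talentedGen (E.src (q.edge k)) i =
      E.talentedGen (E.src (q.edge (k + 1))) (i + 1) := by
    have hfin : (E.outEdges (E.src (q.edge k))).Finite := by simp [hq.outEdges_eq]
    rw [talentedGen_eq_sum i hfin ⟨_, rfl⟩, ← q.rng_edge]
    simp [hq.outEdges_eq]
  have steps (k : ℕ) :
      E.talentedGen (E.src (q.edge 0)) 0 = E.talentedGen (E.src (q.edge k)) k := by
    induction k with
    | zero => rfl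
    | succ k ih => rw [ih, step, Nat.cast_succ]
  refine ⟨talentedGen_ne_zero _ _, Multiplicative.ofAdd (m : ℤ), ?_, ?_⟩
  · simpa using hq.pos.ne'
  · rw [smul_talentedGen, zero_add]
    conv_rhs => rw [steps m, hq.src_eq]
    rfl

theorem exists_isPeriodicElement_iff_hasExitlessCycle :
    (∃ a : E.TalentedMonoid, IsPeriodicElement (Multiplicative ℤ) a) ↔ E.HasExitlessCycle := by
  constructor
  · rintro ⟨a, ha⟩
    obtain ⟨n, hn, y, hy0, hy⟩ := exists_expandOnce_pow_eq_freeShift ha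
    exact hasExitlessCycle_of_expandOnce_pow_eq hy hn hy0
  · rintro ⟨q, m, hq⟩
    exact ⟨_, hq.isPeriodicElement⟩

end Periodic

/-! ### Non-graded ideals from cycles without exits -/

section LeavittFamily

/-- A Leavitt `E`-family: elements of a possibly non-unital semiring that satisfy the defining
relations of the Leavitt path algebra of `E`. -/
structure IsLeavittFamily (E : DirGraph V A) {B : Type*} [NonUnitalSemiring B]
    (g : LeavittGen V A → B) : Prop where
  vertex_mul_self : ∀ v, g (vertex v) * g (vertex v) = g (vertex v)
  vertex_mul_vertex : ∀ v v', v ≠ v' → g (vertex v) * g (vertex v') = 0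
  src_mul_edge : ∀ e, g (vertex (E.src e)) * g (edge e) = g (edge e)
  edge_mul_rng : ∀ e, g (edge e) * g (vertex (E.rng e)) = g (edge e)
  rng_mul_ghost : ∀ e, g (vertex (E.rng e)) * g (ghost e) = g (ghost e)
  ghost_mul_src : ∀ e, g (ghost e) * g (vertex (E.src e)) = g (ghost e)
  ghost_mul_edge_self : ∀ e, g (ghost e) * g (edge e) = g (vertex (E.rng e))
  ghost_mul_edge : ∀ e f, e ≠ f → g (ghost e) * g (edge f) = 0
  vertex_eq_sum : ∀ v (hfin : (E.outEdges v).Finite), (E.outEdges v).Nonempty →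
    g (vertex v) = ∑ e ∈ hfin.toFinset, g (edge e) * g (ghost e)

variable {F : Type x} [Field F]

variable (E F) in
theorem isLeavittFamily_leavittGenUnitization :
    E.IsLeavittFamily (E.leavittGenUnitization F) where
  vertex_mul_self v := by
    simpa [map_mul] using! RingQuot.mkAlgHom_rel F (LeavittRel.vertex_idem (E := E) (F := F) v)
  vertex_mul_vertex v v' h := by
    simpa [map_mul] using! RingQuot.mkAlgHom_rel F (LeavittRel.vertex_orth (E := E) (F := F) v v' h)
  src_mul_edge e := by
    simpa [map_mul] using! RingQuot.mkAlgHom_rel F (LeavittRel.src_edge (E := E) (F := F) e)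
  edge_mul_rng e := by
    simpa [map_mul] using! RingQuot.mkAlgHom_rel F (LeavittRel.edge_rng (E := E) (F := F) e)
  rng_mul_ghost e := by
    simpa [map_mul] using! RingQuot.mkAlgHom_rel F (LeavittRel.rng_ghost (E := E) (F := F) e)
  ghost_mul_src e := by
    simpa [map_mul] using! RingQuot.mkAlgHom_rel F (LeavittRel.ghost_src (E := E) (F := F) e)
  ghost_mul_edge_self e := by
    simpa [map_mul] using! RingQuot.mkAlgHom_rel F (LeavittRel.ck1_same (E := E) (F := F) e)
  ghost_mul_edge e f h := by
    simpa [map_mul] using! RingQuot.mkAlgHom_rel F (LeavittRel.ck1_ne (E := E) (F := F) e f h)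
  vertex_eq_sum v hfin hne := by
    simpa [map_sum, map_mul] using!
      RingQuot.mkAlgHom_rel F (LeavittRel.ck2 (E := E) (F := F) v hfin hne)

namespace IsLeavittFamily

theorem of_map {B C : Type*} [NonUnitalSemiring B] [NonUnitalSemiring C] {g : LeavittGen V A → B}
    {Φ : Type*} [FunLike Φ B C] [NonUnitalRingHomClass Φ B C] {φ : Φ}
    (hφ : Function.Injective φ) (hg : E.IsLeavittFamily (φ ∘ g)) : E.IsLeavittFamily g where
  vertex_mul_self v := hφ (by simpa using hg.vertex_mul_self v)
  vertex_mul_vertex v v' h := hφ (by simpa using hg.vertex_mul_vertex v v' h)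
  src_mul_edge e := hφ (by simpa using hg.src_mul_edge e)
  edge_mul_rng e := hφ (by simpa using hg.edge_mul_rng e)
  rng_mul_ghost e := hφ (by simpa using hg.rng_mul_ghost e)
  ghost_mul_src e := hφ (by simpa using hg.ghost_mul_src e)
  ghost_mul_edge_self e := hφ (by simpa using hg.ghost_mul_edge_self e)
  ghost_mul_edge e f h := hφ (by simpa using hg.ghost_mul_edge e f h)
  vertex_eq_sum v hfin hne := hφ (by simpa using hg.vertex_eq_sum v hfin hne)

end IsLeavittFamily

variable (E F) in
theorem isLeavittFamily_leavittGen : E.IsLeavittFamily (E.leavittGen F) :=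
  .of_map (φ := NonUnitalSubalgebraClass.subtype _) Subtype.val_injective
    (isLeavittFamily_leavittGenUnitization E F)

variable (F) in
/-- The homomorphism from the Leavitt path algebra to a unital algebra given by a Leavitt family. -/
def leavittLift {B : Type*} [Semiring B] [Algebra F B] {g : LeavittGen V A → B}
    (hg : E.IsLeavittFamily g) : E.LeavittPathAlgebra F →ₙₐ[F] B :=
  AlgHom.toNonUnitalAlgHom (RingQuot.liftAlgHom F ⟨FreeAlgebra.lift F g, fun a b h => by
    cases h <;> simp only [map_mul, map_zero, map_sum, FreeAlgebra.lift_ι_apply]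
    exacts [hg.vertex_mul_self _, hg.vertex_mul_vertex _ _ ‹_›, hg.src_mul_edge _,
      hg.edge_mul_rng _, hg.rng_mul_ghost _, hg.ghost_mul_src _, hg.ghost_mul_edge_self _,
      hg.ghost_mul_edge _ _ ‹_›, hg.vertex_eq_sum _ _ ‹_›]⟩) |>.comp
    (NonUnitalSubalgebraClass.subtype _)

@[simp]
theorem leavittLift_leavittGen {B : Type*} [Semiring B] [Algebra F B] {g : LeavittGen V A → B}
    (hg : E.IsLeavittFamily g) (x : LeavittGen V A) :
    leavittLift F hg (E.leavittGen F x) = g x :=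
  (RingQuot.liftAlgHom_mkAlgHom_apply F _ _ _).trans (FreeAlgebra.lift_ι_apply _ _)

theorem leavitt_induction {P : E.LeavittPathAlgebra F → Prop}
    (gen : ∀ x, P (E.leavittGen F x)) (zero : P 0) (add : ∀ a b, P a → P b → P (a + b))
    (mul : ∀ a b, P a → P b → P (a * b)) (smul : ∀ (c : F) a, P a → P (c • a))
    (y : E.LeavittPathAlgebra F) : P y := by
  obtain ⟨y, hy⟩ := y
  induction hy using NonUnitalAlgebra.adjoin_induction with
  | mem y hy =>
    obtain ⟨x, rfl⟩ := hy
    exact gen x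
  | zero => exact zero
  | add a b _ _ ha hb => exact add _ _ ha hb
  | mul a b _ _ ha hb => exact mul _ _ ha hb
  | smul c a _ ha => exact smul c _ ha

theorem leavittGen_mem_component (x : LeavittGen V A) :
    E.leavittGen F x ∈ E.leavittComponent F x.degree :=
  Submodule.subset_span (LeavittMonomial.gen x)

theorem mul_mem_component {m n : ℤ} {y z : E.LeavittPathAlgebra F}
    (hy : y ∈ E.leavittComponent F m) (hz : z ∈ E.leavittComponent F n) :
    y * z ∈ E.leavittComponent F (m + n) := by
  have hle : Submodule.map₂ (LinearMap.mul F _) (E.leavittComponent F m) (E.leavittComponent F n) ≤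
      E.leavittComponent F (m + n) := by
    rw [leavittComponent, leavittComponent, Submodule.map₂_span_span]
    refine Submodule.span_mono ?_
    rintro _ ⟨y, hy, z, hz, rfl⟩
    exact LeavittMonomial.mul hy hz
  exact hle (Submodule.apply_mem_map₂ _ hy hz)

end LeavittFamily

section LeavittQuotient

namespace HereditarySaturated

variable {H : Set V} (hH : E.HereditarySaturated H) {B : Type*} [NonUnitalSemiring B]
  {g : LeavittGen {v // v ∉ H} {e // E.rng e ∉ H} → B}

open Classical in
variable (g) in
/-- Extend a family indexed by the generators of `L_F(E / H)` to the generators of `L_F(E)`, by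
zero on the vertices in `H` and on the edges ending in `H`. -/
noncomputable def extendByZero : LeavittGen V A → B
  | vertex v => if hv : v ∈ H then 0 else g (vertex ⟨v, hv⟩)
  | edge e => if he : E.rng e ∈ H then 0 else g (edge ⟨e, he⟩)
  | ghost e => if he : E.rng e ∈ H then 0 else g (ghost ⟨e, he⟩)

include hH in
theorem isLeavittFamily_extendByZero (hg : hH.quotient.IsLeavittFamily g) :
    E.IsLeavittFamily (extendByZero g) where
  vertex_mul_self v := by
    by_cases hv : v ∈ H <;> simp [extendByZero, hv, hg.vertex_mul_self]
  vertex_mul_vertex v v' h := by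
    by_cases hv : v ∈ H
    · simp [extendByZero, hv]
    by_cases hv' : v' ∈ H
    · simp [extendByZero, hv']
    · simpa [extendByZero, hv, hv'] using hg.vertex_mul_vertex ⟨v, hv⟩ ⟨v', hv'⟩ (by simpa using h)
  src_mul_edge e := by
    by_cases he : E.rng e ∈ H
    · simp [extendByZero, he]
    · simpa [extendByZero, quotient, he, mt (hH.rng_mem e) he] using hg.src_mul_edge ⟨e, he⟩
  edge_mul_rng e := by
    by_cases he : E.rng e ∈ H
    · simp [extendByZero, he]
    · simpa [extendByZero, quotient, he] using hg.edge_mul_rng ⟨e, he⟩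
  rng_mul_ghost e := by
    by_cases he : E.rng e ∈ H
    · simp [extendByZero, he]
    · simpa [extendByZero, quotient, he] using hg.rng_mul_ghost ⟨e, he⟩
  ghost_mul_src e := by
    by_cases he : E.rng e ∈ H
    · simp [extendByZero, he]
    · simpa [extendByZero, quotient, he, mt (hH.rng_mem e) he] using hg.ghost_mul_src ⟨e, he⟩
  ghost_mul_edge_self e := by
    by_cases he : E.rng e ∈ H
    · simp [extendByZero, he]
    · simpa [extendByZero, quotient, he] using hg.ghost_mul_edge_self ⟨e, he⟩
  ghost_mul_edge e f h := by
    by_cases he : E.rng e ∈ H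
    · simp [extendByZero, he]
    by_cases hf : E.rng f ∈ H
    · simp [extendByZero, hf]
    · simpa [extendByZero, he, hf] using hg.ghost_mul_edge ⟨e, he⟩ ⟨f, hf⟩ (by simpa using h)
  vertex_eq_sum v hfin hne := by
    by_cases hv : v ∈ H
    · have hrng : ∀ e ∈ hfin.toFinset, E.rng e ∈ H := fun e he =>
        hH.rng_mem e (by rwa [show E.src e = v by simpa [outEdges] using he])
      simp +contextual [extendByZero, hv, hrng, Finset.sum_eq_zero]
    · have hfin' : (hH.quotient.outEdges ⟨v, hv⟩).Finite := hH.finite_quotient_outEdges hfin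
      rw [← hH.sum_quotient_outEdges hfin hfin' fun e he => by simp [extendByZero, he]]
      have hsum := hg.vertex_eq_sum ⟨v, hv⟩ hfin' (hH.nonempty_quotient_outEdges hne)
      simpa [extendByZero, hv, fun e : {e // E.rng e ∉ H} => e.2] using hsum

end HereditarySaturated

end LeavittQuotient

section Laurent

variable {B : Type*} [Semiring B] {g : LeavittGen V A → B}

theorem IsLeavittFamily.single_degree (hg : E.IsLeavittFamily g) :
    E.IsLeavittFamily fun x => single x.degree (g x) where
  vertex_mul_self v := by rw [single_mul_single, hg.vertex_mul_self]; rfl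
  vertex_mul_vertex v v' h := by
    rw [single_mul_single, hg.vertex_mul_vertex v v' h, single_zero]
  src_mul_edge e := by rw [single_mul_single, hg.src_mul_edge]; rfl
  edge_mul_rng e := by rw [single_mul_single, hg.edge_mul_rng]; rfl
  rng_mul_ghost e := by rw [single_mul_single, hg.rng_mul_ghost]; rfl
  ghost_mul_src e := by rw [single_mul_single, hg.ghost_mul_src]; rfl
  ghost_mul_edge_self e := by rw [single_mul_single, hg.ghost_mul_edge_self]; rfl
  ghost_mul_edge e f h := by
    rw [single_mul_single, hg.ghost_mul_edge e f h, single_zero]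
  vertex_eq_sum v hfin hne := by
    simp only [single_mul_single]
    rw [hg.vertex_eq_sum v hfin hne]
    exact map_sum (singleAddHom (0 : ℤ)) _ _

variable {F : Type x} [Field F] [Algebra F B]

theorem leavittLift_single_degree (hg : E.IsLeavittFamily g) {n : ℤ} {y : E.LeavittPathAlgebra F}
    (hy : y ∈ E.leavittComponent F n) :
    leavittLift F hg.single_degree y = single n (leavittLift F hg y) := by
  induction hy using Submodule.span_induction with
  | zero => rw [map_zero, map_zero, single_zero]
  | add a b _ _ ha hb => rw [map_add, map_add, ha, hb, single_add]
  | smul c a _ ha => rw [map_smul, map_smul, ha, smul_single]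
  | mem y hy =>
    replace hy : E.LeavittMonomial F n y := hy
    induction hy with
    | gen x => rw [leavittLift_leavittGen, leavittLift_leavittGen]
    | mul _ _ ihy ihz => rw [map_mul, map_mul, ihy, ihz, single_mul_single]

/-- If the kernel were graded, then the homomorphism with rescaled generators would vanish on
`y - z` as well, but it separates the degrees `m` and `n`. -/
theorem not_isGradedIdeal_ker_leavittLift {B : Type*} [Ring B] [Algebra F B]
    {g : LeavittGen V A → B} (hg : E.IsLeavittFamily g) {m n : ℤ} (hmn : m ≠ n)
    {y z : E.LeavittPathAlgebra F} (hy : y ∈ E.leavittComponent F m)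
    (hz : z ∈ E.leavittComponent F n) (hyz : leavittLift F hg y = leavittLift F hg z)
    (hy0 : leavittLift F hg y ≠ 0) :
    ¬ E.IsGradedIdeal F (TwoSidedIdeal.ker (leavittLift F hg)) := by
  intro hgr
  have hle : AddSubmonoid.closure {z | z ∈ TwoSidedIdeal.ker (leavittLift F hg) ∧
      ∃ n : ℤ, z ∈ E.leavittComponent F n} ≤
      AddMonoidHom.mker (leavittLift F hg.single_degree) := by
    rw [AddSubmonoid.closure_le]
    rintro z ⟨hz, n, hn⟩
    rw [TwoSidedIdeal.mem_ker] at hz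
    refine AddMonoidHom.mem_mker.2 ((leavittLift_single_degree hg hn).trans ?_)
    rw [hz, single_zero]
  have hdiff : leavittLift F hg.single_degree (y - z) = 0 :=
    hle (hgr (y - z) ((TwoSidedIdeal.mem_ker _).2 (by
      rw [map_sub (leavittLift F hg) y z, hyz, sub_self])))
  rw [map_sub (leavittLift F hg.single_degree) y z, leavittLift_single_degree hg hy,
    leavittLift_single_degree hg hz, ← hyz, sub_eq_zero] at hdiff
  have hcoeff := congrArg (fun p : AddMonoidAlgebra B ℤ => p.coeff m) hdiff
  simp only [coeff_single, Finsupp.single_eq_same, Finsupp.single_eq_of_ne hmn] at hcoeff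
  exact hy0 hcoeff

end Laurent

section PathRepresentation

variable (F : Type x) [Field F]

open Classical in
variable (E) in
/-- The operators by which the generators act on the functions on infinite paths: vertices by
restricting to the paths that start there, edges by pulling back along the removal of that edge, and
ghost edges by pulling back along prepending that edge. -/
noncomputable def pathOperator : LeavittGen V A → Module.End F (E.InfinitePath → F)
  | vertex v => LinearMap.pi fun q => if q.start = v then LinearMap.proj q else 0
  | edge e => LinearMap.pi fun q => if q.edge 0 = e then LinearMap.proj (q.drop 1) else 0
  | ghost e => LinearMap.pi fun q =>
      if h : E.rng e = q.start then LinearMap.proj (q.cons e h) else 0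

open Classical in
@[simp]
theorem pathOperator_vertex_apply (v : V) (f : E.InfinitePath → F) (q : E.InfinitePath) :
    E.pathOperator F (vertex v) f q = if q.start = v then f q else 0 := by
  rw [pathOperator, LinearMap.pi_apply]
  split_ifs <;> rfl

open Classical in
@[simp]
theorem pathOperator_edge_apply (e : A) (f : E.InfinitePath → F) (q : E.InfinitePath) :
    E.pathOperator F (edge e) f q = if q.edge 0 = e then f (q.drop 1) else 0 := by
  rw [pathOperator, LinearMap.pi_apply]
  split_ifs <;> rfl

open Classical in
@[simp]
theorem pathOperator_ghost_apply (e : A) (f : E.InfinitePath → F) (q : E.InfinitePath) :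
    E.pathOperator F (ghost e) f q = if h : E.rng e = q.start then f (q.cons e h) else 0 := by
  rw [pathOperator, LinearMap.pi_apply]
  split_ifs <;> rfl

theorem pathOperator_vertex_eq_sum (v : V) (hfin : (E.outEdges v).Finite) :
    E.pathOperator F (vertex v) =
      ∑ e ∈ hfin.toFinset, E.pathOperator F (edge e) * E.pathOperator F (ghost e) := by
  classical
  ext f q
  have hcons : E.rng (q.edge 0) = (q.drop 1).start := q.start_drop_one.symm
  have hmem : q.edge 0 ∈ hfin.toFinset ↔ q.start = v := hfin.mem_toFinset
  simp only [LinearMap.sum_apply, Finset.sum_apply, Module.End.mul_apply,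
    pathOperator_vertex_apply, pathOperator_edge_apply, pathOperator_ghost_apply]
  rw [Finset.sum_ite_eq]
  simp only [hcons, dif_pos, q.cons_drop_one]
  exact if_congr hmem.symm rfl rfl

theorem isLeavittFamily_pathOperator : E.IsLeavittFamily (E.pathOperator F) where
  vertex_mul_self v := by
    ext f q
    by_cases hv : q.start = v <;> simp [hv]
  vertex_mul_vertex v v' h := by
    ext f q
    by_cases hv : q.start = v <;> simp [hv, h]
  src_mul_edge e := by
    ext f q
    by_cases he : q.edge 0 = e
    · simp [InfinitePath.start, he]
    · simp [he]
  edge_mul_rng e := by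
    ext f q
    by_cases he : q.edge 0 = e <;> simp [q.start_drop_one, he]
  rng_mul_ghost e := by
    ext f q
    by_cases he : E.rng e = q.start <;> simp [he]
  ghost_mul_src e := by
    ext f q
    by_cases he : E.rng e = q.start <;> simp [he]
  ghost_mul_edge_self e := by
    ext f q
    by_cases he : E.rng e = q.start <;> simp [he, eq_comm (a := q.start)]
  ghost_mul_edge e f h := by
    ext k q
    by_cases he : E.rng e = q.start <;> simp [he, h]
  vertex_eq_sum v hfin _ := pathOperator_vertex_eq_sum F v hfin

variable {F} {H : Set V} (hH : E.HereditarySaturated H) {q : hH.quotient.InfinitePath} {m : ℕ}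

theorem IsExitlessCycle.exists_mem_component (hq : IsExitlessCycle q m) (k : ℕ) :
    ∃ y ∈ E.leavittComponent F k, ∀ f,
      let z := leavittLift F (hH.isLeavittFamily_extendByZero (isLeavittFamily_pathOperator F)) y f
      z q = f (q.drop k) ∧ ∀ p ≠ q, z p = 0 := by
  induction k with
  | zero =>
    refine ⟨_, leavittGen_mem_component (vertex (q.start : V)), fun f => ?_⟩
    rw [leavittLift_leavittGen, HereditarySaturated.extendByZero, dif_neg q.start.2]
    refine ⟨?_, fun p hp => ?_⟩
    · exact (pathOperator_vertex_apply F q.start f q).trans (if_pos rfl)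
    · exact (pathOperator_vertex_apply F q.start f p).trans (if_neg (mt hq.eq_of_start_eq hp))
  | succ k ih =>
    obtain ⟨y, hy, hyf⟩ := ih
    refine ⟨_, by simpa using! mul_mem_component hy (leavittGen_mem_component (edge ↑(q.edge k))),
      fun f => ?_⟩
    rw [map_mul, Module.End.mul_apply, leavittLift_leavittGen,
      HereditarySaturated.extendByZero, dif_neg (q.edge k).2]
    refine ⟨?_, (hyf _).2⟩
    rw [(hyf _).1, pathOperator_edge_apply, if_pos (by simp)]
    congr 1
    ext i
    simp [add_comm, add_left_comm]

variable (F) in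
theorem HasQuotientWithExitlessCycle.exists_not_isGradedIdeal
    (h : E.HasQuotientWithExitlessCycle) :
    ∃ J : TwoSidedIdeal (E.LeavittPathAlgebra F), ¬ E.IsGradedIdeal F J := by
  obtain ⟨H, hH, q, m, hq⟩ := h
  obtain ⟨y, hy, hyf⟩ := hq.exists_mem_component (F := F) hH 0
  obtain ⟨z, hz, hzf⟩ := hq.exists_mem_component (F := F) hH m
  have hdrop : q.drop m = q := hq.eq_of_start_eq (by simpa [InfinitePath.start] using hq.src_eq)
  have hm : ((0 : ℕ) : ℤ) ≠ m := Nat.cast_injective.ne hq.pos.ne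
  refine ⟨_, not_isGradedIdeal_ker_leavittLift
    (hH.isLeavittFamily_extendByZero (isLeavittFamily_pathOperator F)) hm hy hz ?_ fun h0 => ?_⟩
  · ext f p
    by_cases hp : p = q
    · rw [hp, (hyf f).1, (hzf f).1, hdrop]
      rfl
    · rw [(hyf f).2 p hp, (hzf f).2 p hp]
  · simpa [h0] using (hyf 1).1

end PathRepresentation

/-! ### Cycles without exits from non-graded ideals -/

section PathProduct

variable {B : Type*} [NonUnitalSemiring B] {g : LeavittGen V A → B}

variable (g) in
/-- The element of an algebra represented by the path with edges `l` and range `v`. The list `l`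
may be empty, and it need not be composable. -/
def pathProd (v : V) : List A → B
  | [] => g (vertex v)
  | e :: l => g (edge e) * pathProd v l

namespace IsLeavittFamily

theorem vertex_mul_edge (hg : E.IsLeavittFamily g) {v : V} {e : A} (h : v ≠ E.src e) :
    g (vertex v) * g (edge e) = 0 := by
  rw [← hg.src_mul_edge, ← mul_assoc, hg.vertex_mul_vertex _ _ h, zero_mul]

theorem ghost_mul_vertex (hg : E.IsLeavittFamily g) {v : V} {e : A} (h : E.src e ≠ v) :
    g (ghost e) * g (vertex v) = 0 := by
  rw [← hg.ghost_mul_src, mul_assoc, hg.vertex_mul_vertex _ _ h, mul_zero]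

theorem pathProd_mul_vertex (hg : E.IsLeavittFamily g) (v : V) (l : List A) :
    pathProd g v l * g (vertex v) = pathProd g v l := by
  induction l with
  | nil => exact hg.vertex_mul_self v
  | cons e l ih => rw [pathProd, mul_assoc, ih]

theorem pathProd_mul_edge (hg : E.IsLeavittFamily g) (e : A) (l : List A) :
    pathProd g (E.src e) l * g (edge e) = pathProd g (E.rng e) (l ++ [e]) := by
  induction l with
  | nil => exact (hg.src_mul_edge e).trans (hg.edge_mul_rng e).symm
  | cons f l ih => rw [List.cons_append, pathProd, pathProd, mul_assoc, ih]

theorem vertex_mul_pathProd_cons (hg : E.IsLeavittFamily g) {u : V} {e : A} (h : u ≠ E.src e)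
    (v : V) (l : List A) : g (vertex u) * pathProd g v (e :: l) = 0 := by
  rw [pathProd, ← mul_assoc, hg.vertex_mul_edge h, zero_mul]

theorem vertex_mul_pathProd (hg : E.IsLeavittFamily g) (u v : V) (l : List A) :
    g (vertex u) * pathProd g v l = 0 ∨ g (vertex u) * pathProd g v l = pathProd g v l := by
  cases l with
  | nil =>
    rcases eq_or_ne u v with rfl | h
    · exact .inr (hg.vertex_mul_self u)
    · exact .inl (hg.vertex_mul_vertex u v h)
  | cons e l =>
    rcases eq_or_ne u (E.src e) with rfl | h
    · exact .inr (by rw [pathProd, ← mul_assoc, hg.src_mul_edge])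
    · exact .inl (hg.vertex_mul_pathProd_cons h v l)

theorem ghost_mul_pathProd_cons_self (hg : E.IsLeavittFamily g) (e : A) (v : V) (l : List A) :
    g (ghost e) * pathProd g v (e :: l) = g (vertex (E.rng e)) * pathProd g v l := by
  rw [pathProd, ← mul_assoc, hg.ghost_mul_edge_self]

theorem ghost_mul_pathProd_cons_of_ne (hg : E.IsLeavittFamily g) {e f : A} (h : e ≠ f) (v : V)
    (l : List A) : g (ghost e) * pathProd g v (f :: l) = 0 := by
  rw [pathProd, ← mul_assoc, hg.ghost_mul_edge _ _ h, zero_mul]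

theorem ghost_mul_pathProd_cons (hg : E.IsLeavittFamily g) (e f : A) (v : V) (l : List A) :
    g (ghost e) * pathProd g v (f :: l) = 0 ∨
      g (ghost e) * pathProd g v (f :: l) = pathProd g v l := by
  rcases eq_or_ne e f with rfl | h
  · rw [hg.ghost_mul_pathProd_cons_self]
    exact hg.vertex_mul_pathProd _ _ _
  · exact .inl (hg.ghost_mul_pathProd_cons_of_ne h v l)

theorem ghost_mul_pathProd_mul_edge (hg : E.IsLeavittFamily g) (e : A) {l : List A} (hl : l ≠ [])
    (h0 : g (ghost e) * pathProd g (E.src e) l * g (edge e) ≠ 0) :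
    l.head? = some e ∧ g (ghost e) * pathProd g (E.src e) l * g (edge e) =
      pathProd g (E.rng e) (l.rotate 1) := by
  obtain ⟨f, l, rfl⟩ := List.exists_cons_of_ne_nil hl
  rcases eq_or_ne e f with rfl | h
  · rw [hg.ghost_mul_pathProd_cons_self, mul_assoc, hg.pathProd_mul_edge] at h0 ⊢
    refine ⟨rfl, ((hg.vertex_mul_pathProd _ _ _).resolve_left h0).trans ?_⟩
    rw [List.rotate_cons_succ, List.rotate_zero]
  · exact absurd (by rw [hg.ghost_mul_pathProd_cons_of_ne h, zero_mul]) h0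

variable {F : Type x} [Field F] [Module F B]

theorem mul_vertex_of_mem_span [IsScalarTower F B B] (hg : E.IsLeavittFamily g) {v : V} {y : B}
    (hy : y ∈ Submodule.span F (Set.range (pathProd g v))) : y * g (vertex v) = y := by
  induction hy using Submodule.span_induction with
  | zero => rw [zero_mul]
  | add a b _ _ ha hb => rw [add_mul, ha, hb]
  | smul c a _ ha => rw [smul_mul_assoc, ha]
  | mem _ hy =>
    obtain ⟨l, rfl⟩ := hy
    exact hg.pathProd_mul_vertex v l

theorem eventually_sum_edge_mul_ghost_mul [SMulCommClass F B B] (hg : E.IsLeavittFamily g) {v : V}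
    {y : B} (hy : y ∈ Submodule.span F (pathProd g v '' {l | l ≠ []})) :
    ∀ᶠ S : Finset A in atTop, ∑ e ∈ S, g (edge e) * (g (ghost e) * y) = y := by
  induction hy using Submodule.span_induction with
  | zero => exact .of_forall fun S => by simp only [mul_zero, Finset.sum_const_zero]
  | add a b _ _ ha hb =>
    filter_upwards [ha, hb] with S ha hb
    simp only [mul_add, Finset.sum_add_distrib, ha, hb]
  | smul c a _ ha =>
    filter_upwards [ha] with S ha
    simp only [mul_smul_comm, ← Finset.smul_sum, ha]
  | mem _ hy =>
    obtain ⟨l, hl, rfl⟩ := hy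
    obtain ⟨f, l, rfl⟩ := List.exists_cons_of_ne_nil hl
    filter_upwards [eventually_ge_atTop {f}] with S hS
    rw [Finset.sum_eq_single_of_mem f (hS (Finset.mem_singleton_self f)) fun e _ he => by
      rw [hg.ghost_mul_pathProd_cons_of_ne he, mul_zero]]
    rw [hg.ghost_mul_pathProd_cons_self, ← mul_assoc, hg.edge_mul_rng, pathProd]

end IsLeavittFamily

end PathProduct

section Reduction

variable {B : Type*} [NonUnitalRing B] {g : LeavittGen V A → B} {J : TwoSidedIdeal B}

theorem IsLeavittFamily.hereditarySaturated_vertex_mem (hg : E.IsLeavittFamily g)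
    (hE : E.RowFinite) (J : TwoSidedIdeal B) :
    E.HereditarySaturated {v | g (vertex v) ∈ J} where
  rng_mem e he := by
    rw [Set.mem_ofPred_eq, ← hg.ghost_mul_edge_self, ← hg.ghost_mul_src]
    exact J.mul_mem_right _ _ (J.mul_mem_left _ _ he)
  mem_of_forall_rng_mem v hne h := by
    rw [Set.mem_ofPred_eq, hg.vertex_eq_sum v (hE v) hne]
    refine sum_mem fun e he => ?_
    rw [← hg.edge_mul_rng]
    exact J.mul_mem_right _ _ (J.mul_mem_left _ _ (h e ((hE v).mem_toFinset.1 he)))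

variable {F : Type x} [Field F] [Module F B] {ι : Type*}

variable (g J) in
/-- The ideal `J` does not contain the vertex `v`, but it contains the sum of `v` and the linear
combination with coefficients `a` of the nonempty paths `l p`, `p ∈ s`, with range `v`. -/
structure IsReduced (a : ι → F) (s : Finset ι) (v : V) (l : ι → List A) : Prop where
  notMem : g (vertex v) ∉ J
  ne_nil : ∀ p ∈ s, l p ≠ []
  add_sum_mem : g (vertex v) + ∑ p ∈ s, a p • pathProd g v (l p) ∈ J

namespace IsReduced

variable {a : ι → F} {s : Finset ι} {v : V} {l : ι → List A} [SMulCommClass F B B]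

theorem exists_src_head_eq (hg : E.IsLeavittFamily g) (h : IsReduced g J a s v l) :
    ∃ p ∈ s, ∃ e ∈ (l p).head?, E.src e = v := by
  by_contra! hsrc
  have hmul : g (vertex v) * ∑ p ∈ s, a p • pathProd g v (l p) = 0 := by
    rw [Finset.mul_sum]
    refine Finset.sum_eq_zero fun p hp => ?_
    obtain ⟨e, l', hl⟩ := List.exists_cons_of_ne_nil (h.ne_nil p hp)
    rw [mul_smul_comm, hl, hg.vertex_mul_pathProd_cons (hsrc p hp e (by simp [hl])).symm,
      smul_zero]
  have hmem := J.mul_mem_left (g (vertex v)) _ h.add_sum_mem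
  rw [mul_add, hmul, add_zero, hg.vertex_mul_self] at hmem
  exact h.notMem hmem

theorem exists_edge (hg : E.IsLeavittFamily g) (hE : E.RowFinite) (h : IsReduced g J a s v l) :
    ∃ e, E.src e = v ∧ g (vertex (E.rng e)) ∉ J := by
  obtain ⟨-, -, f, -, hf⟩ := h.exists_src_head_eq hg
  by_contra! hrng
  exact h.notMem ((hg.hereditarySaturated_vertex_mem hE J).mem_of_forall_rng_mem v ⟨f, hf⟩ hrng)

variable [IsScalarTower F B B]

/-- Replace the element `y` of `J` by `e* y e`: this rotates the closed paths starting with the edge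
`e` and kills all other paths. -/
theorem exists_subset_rotate (hg : E.IsLeavittFamily g) {e : A}
    (h : IsReduced g J a s (E.src e) l) (he : g (vertex (E.rng e)) ∉ J) :
    ∃ t ⊆ s, (∀ p ∈ t, (l p).head? = some e) ∧
      IsReduced g J a t (E.rng e) fun p => (l p).rotate 1 := by
  classical
  let conj (p : ι) : B := g (ghost e) * pathProd g (E.src e) (l p) * g (edge e)
  have conj_eq : ∀ p ∈ s.filter (conj · ≠ 0), (l p).head? = some e ∧
      conj p = pathProd g (E.rng e) ((l p).rotate 1) := fun p hp =>
    hg.ghost_mul_pathProd_mul_edge e (h.ne_nil p (Finset.mem_filter.1 hp).1)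
      (Finset.mem_filter.1 hp).2
  refine ⟨s.filter (conj · ≠ 0), Finset.filter_subset _ _, fun p hp => (conj_eq p hp).1, he,
    fun p hp => by simpa using h.ne_nil p (Finset.mem_filter.1 hp).1, ?_⟩
  have hsum : ∑ p ∈ s.filter (conj · ≠ 0), a p • pathProd g (E.rng e) ((l p).rotate 1) =
      ∑ p ∈ s, a p • conj p := by
    rw [← Finset.sum_filter_of_ne (p := (conj · ≠ 0)) fun p _ hp => right_ne_zero_of_smul hp]
    exact Finset.sum_congr rfl fun p hp => by rw [(conj_eq p hp).2]
  have hmem := J.mul_mem_right _ (g (edge e)) (J.mul_mem_left (g (ghost e)) _ h.add_sum_mem)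
  simpa only [mul_add, add_mul, hg.ghost_mul_src, hg.ghost_mul_edge_self, Finset.mul_sum,
    Finset.sum_mul, mul_smul_comm, smul_mul_assoc, hsum] using hmem

theorem hasQuotientWithExitlessCycle_of_minimal (hg : E.IsLeavittFamily g) (hE : E.RowFinite)
    (h : IsReduced g J a s v l) (hmin : ∀ t ⊂ s, ∀ v l, ¬ IsReduced g J a t v l) :
    E.HasQuotientWithExitlessCycle := by
  obtain ⟨p, hp, -⟩ := h.exists_src_head_eq hg
  have hH := hg.hereditarySaturated_vertex_mem hE J
  have step : ∀ {l e}, IsReduced g J a s (E.src e) l → g (vertex (E.rng e)) ∉ J →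
      (l p).head? = some e ∧ IsReduced g J a s (E.rng e) fun p => (l p).rotate 1 := by
    intro l e h he
    obtain ⟨t, hts, hhead, ht⟩ := h.exists_subset_rotate hg he
    obtain rfl : t = s := hts.eq_of_not_ssubset fun hss => hmin t hss _ _ ht
    exact ⟨hhead p hp, ht⟩
  let W : Set {v // v ∉ {v | g (vertex v) ∈ J}} :=
    {v | ∃ l', IsReduced g J a s v l' ∧ l' p ~r l p}
  have hWfin : W.Finite := by
    refine (((List.finite_toSet (l p)).image E.src).preimage
      Subtype.val_injective.injOn).subset ?_
    rintro v ⟨l', h', hrot⟩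
    obtain ⟨e, hev, he⟩ := h'.exists_edge hg hE
    rw [← hev] at h'
    exact ⟨e, hrot.mem_iff.1 (List.mem_of_mem_head? (step h' he).1), hev⟩
  refine ⟨_, hH, hasExitlessCycle_of_finite hWfin ⟨⟨v, h.notMem⟩, l, h, .refl _⟩ ?_⟩
  rintro ⟨v, hv⟩ ⟨l', h', hrot⟩
  obtain ⟨e, rfl, he⟩ := h'.exists_edge hg hE
  refine ⟨⟨e, he⟩, ?_, _, (step h' he).2, (List.IsRotated.symm ⟨1, rfl⟩).trans hrot⟩
  ext ⟨f, hf⟩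
  rw [hH.mem_quotient_outEdges, Set.mem_singleton_iff, Subtype.mk.injEq]
  refine ⟨fun hfe => ?_, ?_⟩
  · have hhead := (step (hfe ▸ h') hf).1
    exact Option.some_injective _ (hhead.symm.trans (step h' he).1)
  · rintro rfl
    rfl

theorem hasQuotientWithExitlessCycle (hg : E.IsLeavittFamily g) (hE : E.RowFinite)
    (h : IsReduced g J a s v l) : E.HasQuotientWithExitlessCycle := by
  induction s using Finset.strongInduction generalizing v l with
  | H s ih =>
    by_cases hmin : ∀ t ⊂ s, ∀ v l, ¬ IsReduced g J a t v l
    · exact h.hasQuotientWithExitlessCycle_of_minimal hg hE hmin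
    · push Not at hmin
      obtain ⟨t, hts, v, l, ht⟩ := hmin
      exact ih t hts ht

end IsReduced

end Reduction

section GradedPart

variable {F : Type x} [Field F]

theorem pathProd_mem_component (v : V) (l : List A) :
    pathProd (E.leavittGen F) v l ∈ E.leavittComponent F l.length := by
  induction l with
  | nil => exact leavittGen_mem_component (vertex v)
  | cons e l ih =>
    rw [List.length_cons, Nat.cast_add_one, add_comm]
    exact mul_mem_component (leavittGen_mem_component (edge e)) ih

theorem eventually_sum_mul_vertex (y : E.LeavittPathAlgebra F) :
    ∀ᶠ S : Finset V in atTop, ∑ v ∈ S, y * E.leavittGen F (vertex v) = y := by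
  have hg := isLeavittFamily_leavittGen E F
  have of_mul_vertex : ∀ (y : E.LeavittPathAlgebra F) v, y * E.leavittGen F (vertex v) = y →
      ∀ᶠ S : Finset V in atTop, ∑ v ∈ S, y * E.leavittGen F (vertex v) = y := by
    intro y v hyv
    filter_upwards [eventually_ge_atTop {v}] with S hS
    rw [Finset.sum_eq_single_of_mem v (hS (Finset.mem_singleton_self v)) fun u _ hu => ?_, hyv]
    rw [← hyv, mul_assoc, hg.vertex_mul_vertex v u hu.symm, mul_zero]
  induction y using leavitt_induction with
  | gen x =>
    cases x with
    | vertex v => exact of_mul_vertex _ _ (hg.vertex_mul_self v)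
    | edge e => exact of_mul_vertex _ _ (hg.edge_mul_rng e)
    | ghost e => exact of_mul_vertex _ _ (hg.ghost_mul_src e)
  | zero => exact .of_forall fun S => by simp only [zero_mul, Finset.sum_const_zero]
  | add a b ha hb =>
    filter_upwards [ha, hb] with S ha hb
    simp only [add_mul, Finset.sum_add_distrib, ha, hb]
  | mul a b _ hb =>
    filter_upwards [hb] with S hb
    simp only [mul_assoc, ← Finset.mul_sum, hb]
  | smul c a ha =>
    filter_upwards [ha] with S ha
    simp only [smul_mul_assoc, ← Finset.smul_sum, ha]

variable (E) in
/-- A condition on the edge list `l` and the range `v` of a path: it has length at least `k` or it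
cannot be extended. -/
def LongOrSink (k : ℕ) (v : V) (l : List A) : Prop :=
  k ≤ l.length ∨ ¬ (E.outEdges v).Nonempty

theorem LongOrSink.mono {k m : ℕ} {v : V} {l : List A} (h : E.LongOrSink k v l) (hm : m ≤ k) :
    E.LongOrSink m v l :=
  h.imp_left hm.trans

theorem mul_mem_of_mem_span_pathProd {y z : E.LeavittPathAlgebra F} {v : V} {S : Set (List A)}
    {N : Submodule F (E.LeavittPathAlgebra F)}
    (h : ∀ l ∈ S, y * pathProd (E.leavittGen F) v l ∈ N)
    (hz : z ∈ Submodule.span F (pathProd (E.leavittGen F) v '' S)) : y * z ∈ N :=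
  (Submodule.span_le (p := N.comap (LinearMap.mulLeft F y))).2 (Set.forall_mem_image.2 h) hz

theorem leavittGen_mul_pathProd_mem_span (x : LeavittGen V A) {m : ℕ} {v : V} {l : List A}
    (h : E.LongOrSink (m + 1) v l) :
    E.leavittGen F x * pathProd (E.leavittGen F) v l ∈
      Submodule.span F (pathProd (E.leavittGen F) v '' {l | E.LongOrSink m v l}) := by
  have hg := isLeavittFamily_leavittGen E F
  cases x with
  | vertex u =>
    obtain h0 | h0 := hg.vertex_mul_pathProd u v l <;> rw [h0]
    exacts [zero_mem _, Submodule.subset_span ⟨l, h.mono m.le_succ, rfl⟩]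
  | edge e =>
    exact Submodule.subset_span
      ⟨e :: l, h.imp_left fun h => m.le_succ.trans (h.trans (Nat.le_succ _)), rfl⟩
  | ghost e =>
    cases l with
    | nil =>
      have hv : ¬ (E.outEdges v).Nonempty := h.resolve_left (Nat.not_succ_le_zero m)
      rw [pathProd, hg.ghost_mul_vertex fun he => hv ⟨e, he⟩]
      exact zero_mem _
    | cons f l =>
      obtain h0 | h0 := hg.ghost_mul_pathProd_cons e f v l <;> rw [h0]
      exacts [zero_mem _, Submodule.subset_span ⟨l, h.imp_left Nat.le_of_succ_le_succ, rfl⟩]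

/-- Multiplying by a sufficiently long path cancels all ghost edges. -/
theorem exists_mul_pathProd_mem_span (y : E.LeavittPathAlgebra F) (m : ℕ) :
    ∃ n, ∀ v l, E.LongOrSink n v l → y * pathProd (E.leavittGen F) v l ∈
      Submodule.span F (pathProd (E.leavittGen F) v '' {l | E.LongOrSink m v l}) := by
  induction y using leavitt_induction generalizing m with
  | gen x => exact ⟨m + 1, fun _ _ h => leavittGen_mul_pathProd_mem_span x h⟩
  | zero => exact ⟨0, fun v l _ => by rw [zero_mul]; exact zero_mem _⟩
  | add a b ha hb =>
    obtain ⟨n, hn⟩ := ha m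
    obtain ⟨k, hk⟩ := hb m
    refine ⟨max n k, fun v l h => ?_⟩
    rw [add_mul]
    exact add_mem (hn v l (h.mono (le_max_left _ _))) (hk v l (h.mono (le_max_right _ _)))
  | mul a b ha hb =>
    obtain ⟨n, hn⟩ := ha m
    obtain ⟨k, hk⟩ := hb n
    refine ⟨k, fun v l h => ?_⟩
    rw [mul_assoc]
    exact mul_mem_of_mem_span_pathProd (hn v) (hk v l h)
  | smul c a ha =>
    obtain ⟨n, hn⟩ := ha m
    refine ⟨n, fun v l h => ?_⟩
    rw [smul_mul_assoc]
    exact Submodule.smul_mem _ c (hn v l h)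

variable {J : TwoSidedIdeal (E.LeavittPathAlgebra F)}

variable (J) in
/-- The finite sums of homogeneous elements of the ideal `J`; this is the largest graded ideal
contained in `J`. -/
def gradedPart : AddSubmonoid (E.LeavittPathAlgebra F) :=
  AddSubmonoid.closure {z | z ∈ J ∧ ∃ n : ℤ, z ∈ E.leavittComponent F n}

theorem mul_mem_gradedPart_of_mem_component_right {y z : E.LeavittPathAlgebra F} {n : ℤ}
    (hy : y ∈ gradedPart J) (hz : z ∈ E.leavittComponent F n) : y * z ∈ gradedPart J := by
  induction hy using AddSubmonoid.closure_induction with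
  | zero => rw [zero_mul]; exact zero_mem _
  | add a b _ _ ha hb => rw [add_mul]; exact add_mem ha hb
  | mem y hy =>
    obtain ⟨hyJ, m, hm⟩ := hy
    exact AddSubmonoid.subset_closure ⟨J.mul_mem_right _ _ hyJ, _, mul_mem_component hm hz⟩

theorem mul_mem_gradedPart_of_mem_component_left {y z : E.LeavittPathAlgebra F} {n : ℤ}
    (hz : z ∈ E.leavittComponent F n) (hy : y ∈ gradedPart J) : z * y ∈ gradedPart J := by
  induction hy using AddSubmonoid.closure_induction with
  | zero => rw [mul_zero]; exact zero_mem _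
  | add a b _ _ ha hb => rw [mul_add]; exact add_mem ha hb
  | mem y hy =>
    obtain ⟨hyJ, m, hm⟩ := hy
    exact AddSubmonoid.subset_closure ⟨J.mul_mem_left _ _ hyJ, _, mul_mem_component hz hm⟩

theorem exists_mul_pathProd_notMem_gradedPart (hE : E.RowFinite) {y : E.LeavittPathAlgebra F}
    (hy : y ∉ gradedPart J) (k : ℕ) :
    ∃ v l, E.LongOrSink k v l ∧ y * pathProd (E.leavittGen F) v l ∉ gradedPart J := by
  have hg := isLeavittFamily_leavittGen E F
  induction k with
  | zero =>
    by_contra! h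
    obtain ⟨S, hS⟩ := (eventually_sum_mul_vertex y).exists
    exact hy (hS ▸ sum_mem fun v _ => h v [] (.inl (Nat.zero_le _)))
  | succ k ih =>
    obtain ⟨v, l, hl, hyl⟩ := ih
    by_cases hv : (E.outEdges v).Nonempty
    swap
    · exact ⟨v, l, .inr hv, hyl⟩
    by_contra! h
    refine hyl ?_
    rw [← hg.pathProd_mul_vertex, hg.vertex_eq_sum v (hE v) hv, Finset.mul_sum, Finset.mul_sum]
    refine sum_mem fun e he => ?_
    obtain rfl : E.src e = v := (hE v).mem_toFinset.1 he
    have hlong : k + 1 ≤ (l ++ [e]).length := by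
      simpa using hl.resolve_right (not_not.2 hv)
    rw [← mul_assoc, ← mul_assoc, mul_assoc y, hg.pathProd_mul_edge]
    exact mul_mem_gradedPart_of_mem_component_right (h _ _ (.inl hlong))
      (leavittGen_mem_component (ghost e))

theorem mem_gradedPart_of_vertex_mem {v : V} (hv : E.leavittGen F (vertex v) ∈ J)
    {y : E.LeavittPathAlgebra F}
    (hy : y ∈ Submodule.span F (Set.range (pathProd (E.leavittGen F) v))) :
    y ∈ gradedPart J := by
  have hg := isLeavittFamily_leavittGen E F
  induction hy using Submodule.span_induction with
  | zero => exact zero_mem _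
  | add a b _ _ ha hb => exact add_mem ha hb
  | smul c a ha ih =>
    rw [← hg.mul_vertex_of_mem_span ha, ← mul_smul_comm]
    exact mul_mem_gradedPart_of_mem_component_right ih
      (Submodule.smul_mem _ c (leavittGen_mem_component (vertex v)))
  | mem _ hy =>
    obtain ⟨l, rfl⟩ := hy
    rw [← hg.pathProd_mul_vertex]
    exact mul_mem_gradedPart_of_mem_component_left (pathProd_mem_component v l)
      (AddSubmonoid.subset_closure ⟨hv, _, leavittGen_mem_component (vertex v)⟩)

/-- A combination of paths without constant term can be shortened by a ghost edge. -/
theorem exists_smul_vertex_add_mem {v : V} {N : ℕ} {y : E.LeavittPathAlgebra F} (hyJ : y ∈ J)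
    (hy : y ∉ gradedPart J)
    (hyN : y ∈ Submodule.span F (pathProd (E.leavittGen F) v '' {l | l.length < N})) :
    ∃ c : F, c ≠ 0 ∧ ∃ z ∈ Submodule.span F (pathProd (E.leavittGen F) v '' {l | l ≠ []}),
      c • E.leavittGen F (vertex v) + z ∈ J := by
  have hg := isLeavittFamily_leavittGen E F
  induction N generalizing y with
  | zero =>
    simp only [Nat.not_lt_zero, Set.ofPred_false, Set.image_empty, Submodule.span_empty,
      Submodule.mem_bot] at hyN
    exact absurd (hyN ▸ zero_mem _) hy
  | succ N ih =>
    have hsub : pathProd (E.leavittGen F) v '' {l | l.length < N + 1} ⊆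
        insert (E.leavittGen F (vertex v))
          (pathProd (E.leavittGen F) v '' {l | l ≠ [] ∧ l.length < N + 1}) := by
      rintro _ ⟨l, hl, rfl⟩
      obtain rfl | h := eq_or_ne l []
      exacts [.inl rfl, .inr ⟨l, ⟨h, hl⟩, rfl⟩]
    obtain ⟨c, z, hz, rfl⟩ := Submodule.mem_span_insert.1 (Submodule.span_mono hsub hyN)
    have hz' := Submodule.span_mono (Set.image_mono fun l hl => hl.1) hz
    obtain rfl | hc := eq_or_ne c 0
    swap
    · exact ⟨c, hc, z, hz', hyJ⟩
    rw [zero_smul, zero_add] at hyJ hy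
    obtain ⟨e, he⟩ : ∃ e, E.leavittGen F (ghost e) * z ∉ gradedPart J := by
      by_contra! h
      obtain ⟨S, hS⟩ := (hg.eventually_sum_edge_mul_ghost_mul hz').exists
      exact hy (hS ▸ sum_mem fun e _ =>
        mul_mem_gradedPart_of_mem_component_left (leavittGen_mem_component (edge e)) (h e))
    refine ih (J.mul_mem_left _ _ hyJ) he (mul_mem_of_mem_span_pathProd ?_ hz)
    rintro l ⟨hl, hlN⟩
    obtain ⟨f, l, rfl⟩ := List.exists_cons_of_ne_nil hl
    obtain h0 | h0 := hg.ghost_mul_pathProd_cons e f v l <;> rw [h0]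
    exacts [zero_mem _, Submodule.subset_span ⟨l, Nat.lt_of_succ_lt_succ hlN, rfl⟩]

theorem exists_isReduced {v : V} (hv : E.leavittGen F (vertex v) ∉ J) {c : F} (hc : c ≠ 0)
    {z : E.LeavittPathAlgebra F}
    (hz : z ∈ Submodule.span F (pathProd (E.leavittGen F) v '' {l | l ≠ []}))
    (hmem : c • E.leavittGen F (vertex v) + z ∈ J) :
    ∃ (a : List A → F) (s : Finset (List A)), IsReduced (E.leavittGen F) J a s v id := by
  have hg := isLeavittFamily_leavittGen E F
  obtain ⟨a, ha, hsum⟩ := (Finsupp.mem_span_image_iff_linearCombination F).1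
    (Submodule.smul_mem _ c⁻¹ hz)
  refine ⟨a, a.support, hv, fun l hl => ha hl, ?_⟩
  have hzv : z * E.leavittGen F (vertex v) = z :=
    hg.mul_vertex_of_mem_span (Submodule.span_mono (Set.image_subset_range _ _) hz)
  have hscale : (c • E.leavittGen F (vertex v) + z) * c⁻¹ • E.leavittGen F (vertex v) =
      E.leavittGen F (vertex v) + c⁻¹ • z := by
    rw [mul_smul_comm, add_mul, smul_mul_assoc, hg.vertex_mul_self, hzv, smul_add,
      inv_smul_smul₀ hc]
  rw [← hsum] at hscale
  exact hscale ▸ J.mul_mem_right _ _ hmem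

theorem hasQuotientWithExitlessCycle_of_not_isGradedIdeal (hE : E.RowFinite)
    (hJ : ¬ E.IsGradedIdeal F J) : E.HasQuotientWithExitlessCycle := by
  have hg := isLeavittFamily_leavittGen E F
  obtain ⟨x, hxJ, hx⟩ : ∃ x ∈ J, x ∉ gradedPart J := by simpa [IsGradedIdeal] using! hJ
  obtain ⟨n, hn⟩ := exists_mul_pathProd_mem_span x 0
  obtain ⟨v, l, hl, hxl⟩ := exists_mul_pathProd_notMem_gradedPart hE hx n
  have hspan := Submodule.span_mono (Set.image_subset_range _ _) (hn v l hl)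
  have hv : E.leavittGen F (vertex v) ∉ J := fun h => hxl (mem_gradedPart_of_vertex_mem h hspan)
  obtain ⟨N, hN⟩ : ∃ N, x * pathProd (E.leavittGen F) v l ∈
      Submodule.span F (pathProd (E.leavittGen F) v '' {l | l.length < N}) := by
    obtain ⟨a, ha⟩ := Finsupp.mem_span_range_iff_exists_finsupp.1 hspan
    refine ⟨a.support.sup List.length + 1, ha ▸ sum_mem fun l hl => Submodule.smul_mem _ _ ?_⟩
    exact Submodule.subset_span ⟨l, Nat.lt_succ_of_le (Finset.le_sup hl), rfl⟩
  obtain ⟨c, hc, z, hz, hzJ⟩ := exists_smul_vertex_add_mem (J.mul_mem_right _ _ hxJ) hxl hN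
  obtain ⟨a, s, h⟩ := exists_isReduced hv hc hz hzJ
  exact h.hasQuotientWithExitlessCycle hg hE

end GradedPart

end DirGraph

theorem proposition4p2 {V : Type u} {A : Type w} (E : DirGraph V A) (hE : E.RowFinite)
    (F : Type x) [Field F] :
    (∃ J : TwoSidedIdeal (E.LeavittPathAlgebra F), ¬ E.IsGradedIdeal F J) ↔
      ∃ (I : OrderIdeal (Multiplicative ℤ) E.TalentedMonoid) (a : I.Quotient),
        IsPeriodicElement (Multiplicative ℤ) a := by
  calc
    _ ↔ E.HasQuotientWithExitlessCycle :=
        ⟨fun ⟨_, hJ⟩ => DirGraph.hasQuotientWithExitlessCycle_of_not_isGradedIdeal hE hJ,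
          fun h => h.exists_not_isGradedIdeal F⟩
    _ ↔ ∃ (H : Set V) (hH : E.HereditarySaturated H) (a : hH.quotient.TalentedMonoid),
          IsPeriodicElement (Multiplicative ℤ) a :=
        exists₂_congr fun _ _ => DirGraph.exists_isPeriodicElement_iff_hasExitlessCycle.symm
    _ ↔ _ := (DirGraph.exists_isPeriodicElement_quotient_iff hE).symm
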